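/- A nondeterministic Büchi automaton $\mathcal{A}=\langle\Sigma,Q,\delta,Q_0,\alpha\rangle$ consists of a finite alphabet $\Sigma$, a finite set of states $Q$, a transition function $\delta:Q\times\Sigma\to 2^Q$, a set $Q_0\subseteq Q$ of initial states and a set $\alpha\subseteq Q$ of accepting states; its language $\mathfrak{L}(\mathcal{A})\subseteq\Sigma^\omega$ is the set of infinite words on which $\mathcal{A}$ has a run that visits some state of $\alpha$ infinitely often. Two words $w,w'\in\Sigma^\omega$ are permutations of each other, written $w\sim w'$, if every letter of $\Sigma$ has the same number of occurrences (an element of $\mathbb{N}\cup\{\infty\}$) in $w$ and in $w'$. The jumping language of $\mathcal{A}$ is \[\mathfrak{J}(\mathcal{A})=\{w\in\Sigma^\omega \mid \exists\, w'\sim w \text{ such that } w'\in\mathfrak{L}(\mathcal{A})\}.\] Proposition. Given Büchi automata $\mathcal{A}$ and $\mathcal{B}$ over a common finite alphabet $\Sigma$, one can effectively construct an automaton $\mathcal{C}$ over $\Sigma$ such that $\mathfrak{J}(\mathcal{C})=\mathfrak{J}(\mathcal{A})\cap\mathfrak{J}(\mathcal{B})$. That is, there is a computable function which maps $|\Sigma|$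 and finite descriptions of any two such automata $\mathcal{A},\mathcal{B}$ to a description of such a $\mathcal{C}$. -/

import Mathlib

namespace JumpingAutomata

universe u v

/-! Automata are Mathlib's `NFA α Q` (transition function `Q → α → Set Q`, a set of initial states
and a set of accepting states), read here over infinite words `ℕ → α` with Büchi acceptance. The
alphabet `α` and the state type `Q` are finite in all uses. -/

/-- `ρ` is a run of `A` on the infinite word `w`; the letter `w i` is read between the states `ρ i`
and `ρ (i + 1)`. -/
def IsRun {α : Type u} {Q : Type v} (A : NFA α Q) (w : ℕ → α) (ρ : ℕ → Q) : Prop :=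
  ρ 0 ∈ A.start ∧ ∀ i, ρ (i + 1) ∈ A.step (ρ i) (w i)

/-- The states that a sequence visits infinitely often. -/
def infStates {Q : Type v} (ρ : ℕ → Q) : Set Q :=
  {q | ∀ i, ∃ j, i < j ∧ ρ j = q}

/-- The language of infinite words accepted by `A` under the Büchi condition. -/
def buchiLanguage {α : Type u} {Q : Type v} (A : NFA α Q) : Set (ℕ → α) :=
  {w | ∃ ρ : ℕ → Q, IsRun A w ρ ∧ (infStates ρ ∩ A.accept).Nonempty}

/-- The Parikh image of an infinite word: each letter is sent to its number of occurrences,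
which is `⊤` if the letter occurs infinitely often. -/
noncomputable def parikh {α : Type u} (w : ℕ → α) : α → ℕ∞ :=
  fun a => {i : ℕ | w i = a}.encard

/-- The jumping language of `A`: the infinite words with a permutation (that is, a word with the
same Parikh image) accepted by `A`. -/
def jumpingLanguage {α : Type u} {Q : Type v} (A : NFA α Q) : Set (ℕ → α) :=
  {w | ∃ w' : ℕ → α, parikh w' = parikh w ∧ w' ∈ buchiLanguage A}

/-- Finite descriptions of automata, the inputs and outputs of algorithms: the number of states,
the list of transitions (source, letter, target), the list of initial states and the list of
accepting states, where states and letters are given by their numbers. Entries that are out of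
range carry no meaning. -/
abbrev AutomatonCode : Type := ℕ × List (ℕ × ℕ × ℕ) × List ℕ × List ℕ

namespace AutomatonCode

/-- The number of states. -/
abbrev numStates (c : AutomatonCode) : ℕ := c.1

/-- The list of transitions. -/
abbrev transitions (c : AutomatonCode) : List (ℕ × ℕ × ℕ) := c.2.1

/-- The list of initial states. -/
abbrev initial (c : AutomatonCode) : List ℕ := c.2.2.1

/-- The list of accepting states. -/
abbrev accepting (c : AutomatonCode) : List ℕ := c.2.2.2

/-- The automaton described by `c`, over an alphabet whose letters are numbered by `e`. -/
def toNFA {α : Type u} {k : ℕ} (c : AutomatonCode) (e : α ≃ Fin k) : NFA α (Fin c.numStates) where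
  step q a := {q' | ((q : ℕ), (e a : ℕ), (q' : ℕ)) ∈ c.transitions}
  start := {q | (q : ℕ) ∈ c.initial}
  accept := {q | (q : ℕ) ∈ c.accepting}

/-- `c` describes the automaton `A`, over an alphabet whose letters are numbered by `e`: under some
numbering of the states of `A`, the data of `A` are those listed in `c`. -/
def Describes {α : Type u} {Q : Type v} {k : ℕ} (c : AutomatonCode) (e : α ≃ Fin k)
    (A : NFA α Q) : Prop :=
  ∃ g : Q ≃ Fin c.numStates,
    (∀ q a q', q' ∈ A.step q a ↔ ((g q : ℕ), (e a : ℕ), (g q' : ℕ)) ∈ c.transitions) ∧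
    (∀ q, q ∈ A.start ↔ (g q : ℕ) ∈ c.initial) ∧
    (∀ q, q ∈ A.accept ↔ (g q : ℕ) ∈ c.accepting)

theorem describes_toNFA {α : Type u} {k : ℕ} (c : AutomatonCode) (e : α ≃ Fin k) :
    c.Describes e (c.toNFA e) :=
  ⟨Equiv.refl _, fun _ _ _ => Iff.rfl, fun _ => Iff.rfl, fun _ => Iff.rfl⟩

/-- Every finite automaton has a description. -/
theorem exists_describes {α : Type u} {Q : Type v} [Finite Q] {k : ℕ} (e : α ≃ Fin k)
    (A : NFA α Q) : ∃ c : AutomatonCode, c.Describes e A := by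
  classical
  obtain ⟨n, ⟨g⟩⟩ := Finite.exists_equiv_fin Q
  have : Finite α := Finite.of_equiv _ e.symm
  have hT : {t : ℕ × ℕ × ℕ | ∃ q a q', q' ∈ A.step q a ∧
      t = ((g q : ℕ), (e a : ℕ), (g q' : ℕ))}.Finite := by
    refine (Set.finite_range
      (fun x : Q × α × Q => ((g x.1 : ℕ), (e x.2.1 : ℕ), (g x.2.2 : ℕ)))).subset ?_
    rintro _ ⟨q, a, q', _, rfl⟩
    exact ⟨(q, a, q'), rfl⟩
  have hI : ((fun q => (g q : ℕ)) '' A.start).Finite := Set.toFinite _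
  have hF : ((fun q => (g q : ℕ)) '' A.accept).Finite := Set.toFinite _
  refine ⟨(n, hT.toFinset.toList, hI.toFinset.toList, hF.toFinset.toList), g, ?_, ?_, ?_⟩
  · intro q a q'
    simp only [transitions, Finset.mem_toList, Set.Finite.mem_toFinset, Set.mem_ofPred_eq,
      Prod.mk.injEq, Fin.val_inj, EmbeddingLike.apply_eq_iff_eq]
    exact ⟨fun h => ⟨q, a, q', h, rfl, rfl, rfl⟩,
      fun ⟨_, _, _, h, h₁, h₂, h₃⟩ => by rw [h₁, h₂, h₃]; exact h⟩
  · intro q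
    simp [initial, Fin.val_inj]
  · intro q
    simp [accepting, Fin.val_inj]

end AutomatonCode

end JumpingAutomata

/-! Membership in a jumping language depends only on the Parikh image: the nonempty set `S` of
letters occurring infinitely often, and the finite counts `v` of the others. An automaton accepts
some word with these data iff it has a walk from an initial state to an accepting state `q` with
counts `v` outside `S`, and a closed walk at `q` that reads exactly the letters in `S`. This is
`Accepts`; the equivalence is `accepts_of_mem_jumpingLanguage` and `mem_jumpingLanguage_of_accepts`.

By `IsWalk.exists_reduction`, the first walk can be rearranged into a walk of bounded length
together with closed walks of bounded length that start on it. The intersection automaton guesses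
`S` and one such short walk for each of the two automata. It then attaches short closed walks on
either side, one at a time, while reading an input letter at every step. For each side it stores how
many letters have been produced by the walks but not yet read. When both balances return to zero,
the words read and produced agree outside `S`, and the automaton turns to reading `S` cyclically
forever.

Finitely many states suffice because the balances can be kept bounded. All contributions (initial
walks, closed walks, read letters) are bounded integer vectors in dimension `2 * k` with sum zero,
so by the Steinitz lemma `exists_perm_prefix_sum_bounded` they have an order with bounded partial
sums. Any order is allowed, since closed walks can be inserted in any order and the input may be
permuted.

Soundness is `accepts_of_accepts_jointCode`, completeness is `accepts_jointCode`. The construction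
consists of bounded searches through explicit lists, so it is primitive recursive
(`primrec_jointCode`). -/

namespace JumpingAutomata

/-! ### The Steinitz lemma on rearrangements with bounded partial sums. -/

section Steinitz

variable {κ ι : Type*}

/-- The weights in `[0, 1]` with prescribed sum under which the vectors `v` balance. -/
def balancedWeights [Fintype κ] (v : κ → ι → ℝ) (c : ℝ) : Set (κ → ℝ) :=
  {x | x ∈ Set.Icc 0 1 ∧ ∑ j, x j = c ∧ ∀ i, ∑ j, x j * v j i = 0}

theorem isCompact_balancedWeights [Fintype κ] (v : κ → ι → ℝ) (c : ℝ) :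
    IsCompact (balancedWeights v c) := by
  refine (isCompact_Icc (a := (0 : κ → ℝ)) (b := 1)).inter_right
    (t := {x | ∑ j, x j = c ∧ ∀ i, ∑ j, x j * v j i = 0}) ?_
  refine IsClosed.and (isClosed_eq (by fun_prop) (by fun_prop)) ?_
  simp only [Set.ofPred_forall]
  exact isClosed_iInter fun i => isClosed_eq (by fun_prop) (by fun_prop)

/-- More than `card ι + 1` coordinates leave a nonzero balanced direction. -/
theorem exists_balanced_direction [Fintype ι] [Fintype κ] (v : κ → ι → ℝ) (F : Finset κ)
    (hF : Fintype.card ι + 1 < F.card) :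
    ∃ g : κ → ℝ, g ≠ 0 ∧ (∀ j ∉ F, g j = 0) ∧ ∑ j, g j = 0 ∧ ∀ i, ∑ j, g j * v j i = 0 := by
  classical
  -- The extra coordinate `none` records the sum of the weights, so the target has dimension `card ι
  -- + 1`.
  let T : (F → ℝ) →ₗ[ℝ] (Option ι → ℝ) :=
    { toFun := fun g o => ∑ j, g j * (o.elim 1 (v j))
      map_add' := fun g h => by
        ext o; simp [add_mul, Finset.sum_add_distrib]
      map_smul' := fun r g => by
        ext o; simp [Finset.mul_sum, mul_assoc] }
  have hker : LinearMap.ker T ≠ ⊥ := by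
    apply LinearMap.ker_ne_bot_of_finrank_lt
    simpa using hF
  obtain ⟨g, hg, hg0⟩ := Submodule.exists_mem_ne_zero_of_ne_bot hker
  have hT : ∀ o : Option ι, ∑ j, g j * (o.elim 1 (v j)) = 0 := fun o => congrFun hg o
  have hext : ∀ h : κ → ℝ, ∑ j, (if hj : j ∈ F then g ⟨j, hj⟩ else 0) * h j
      = ∑ j : F, g j * h j := by
    intro h
    rw [← Finset.sum_subset (Finset.subset_univ F), ← Finset.sum_coe_sort]
    · exact Finset.sum_congr rfl fun j _ => by simp
    · intro j _ hj; simp [hj]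
  refine ⟨fun j => if hj : j ∈ F then g ⟨j, hj⟩ else 0, ?_, fun j hj => by simp [hj], ?_, ?_⟩
  · intro h
    apply hg0
    ext j
    simpa using congrFun h j
  · have := hext fun _ => 1
    simp only [mul_one] at this
    rw [this]
    simpa using hT none
  · intro i
    rw [hext fun j => v j i]
    exact hT (some i)

/-- An extreme point has a zero coordinate. If all weights were positive, the weights below `1`
would have defects `1 - x j < 1` with sum `card ι + 1`, so there would be more than `card ι + 1` of
them. A balanced direction supported on these coordinates could then be followed a little both ways,
against extremality. -/
theorem exists_weight_eq_zero [Fintype ι] [Fintype κ] (v : κ → ι → ℝ)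
    (hne : (balancedWeights v (Fintype.card κ - 1 - Fintype.card ι)).Nonempty) :
    ∃ x ∈ balancedWeights v (Fintype.card κ - 1 - Fintype.card ι), ∃ j, x j = 0 := by
  classical
  obtain ⟨x, hx, hext⟩ := (isCompact_balancedWeights v _).extremePoints_nonempty hne
  refine ⟨x, hx, ?_⟩
  by_contra! hpos
  obtain ⟨⟨h0, h1⟩, hsum, hbal⟩ := hx
  have h0' : ∀ j, 0 < x j := fun j => lt_of_le_of_ne (h0 j) (hpos j).symm
  have h1' : ∀ j, x j ≤ 1 := h1
  let F : Finset κ := Finset.univ.filter fun j => x j < 1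
  have hFsum : ∑ j ∈ F, (1 - x j) = Fintype.card ι + 1 := by
    have : ∑ j, (1 - x j) = Fintype.card ι + 1 := by
      rw [Finset.sum_sub_distrib, hsum]; simp; ring
    rw [← this]
    refine Finset.sum_subset (Finset.subset_univ F) fun j _ hj => ?_
    have : ¬ x j < 1 := by simpa [F] using hj
    linarith [h1' j]
  have hFcard : Fintype.card ι + 1 < F.card := by
    have hne : F.Nonempty := by
      by_contra h
      rw [Finset.not_nonempty_iff_eq_empty] at h
      rw [h, Finset.sum_empty] at hFsum
      have : (0 : ℝ) ≤ Fintype.card ι := by positivity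
      linarith
    have : ∑ j ∈ F, (1 - x j) < ∑ j ∈ F, (1 : ℝ) :=
      Finset.sum_lt_sum_of_nonempty hne fun j _ => by linarith [h0' j]
    rw [hFsum] at this
    simp only [Finset.sum_const, nsmul_eq_mul, mul_one] at this
    exact_mod_cast this
  obtain ⟨g, hg0, hgF, hgsum, hgbal⟩ := exists_balanced_direction v F hFcard
  obtain ⟨ε, hε, hεx⟩ : ∃ ε > 0, ∀ j, ε * |g j| ≤ x j ∧ ε * |g j| ≤ 1 - x j := by
    have key : ∀ j, ∀ᶠ ε in nhdsWithin (0 : ℝ) (Set.Ioi 0),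
        ε * |g j| ≤ x j ∧ ε * |g j| ≤ 1 - x j := by
      intro j
      by_cases hj : j ∈ F
      · have hlt : x j < 1 := by simpa [F] using hj
        have ht : Filter.Tendsto (fun ε : ℝ => ε * |g j|) (nhdsWithin 0 (Set.Ioi 0)) (nhds 0) := by
          have : Filter.Tendsto (fun ε : ℝ => ε * |g j|) (nhds 0) (nhds (0 * |g j|)) :=
            Continuous.tendsto (by fun_prop) 0
          rw [zero_mul] at this
          exact this.mono_left nhdsWithin_le_nhds
        exact (ht.eventually_le_const (h0' j)).and (ht.eventually_le_const (by linarith))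
      · refine Filter.Eventually.of_forall fun ε => ?_
        rw [hgF j hj]
        simp only [abs_zero, mul_zero]
        exact ⟨h0 j, by linarith [h1' j]⟩
    obtain ⟨ε, hε, h⟩ := ((Filter.eventually_all.2 key).and self_mem_nhdsWithin).exists
    exact ⟨ε, h, hε⟩
  have hmem : ∀ s : ℝ, |s| = ε → x + s • g ∈
      balancedWeights v (Fintype.card κ - 1 - Fintype.card ι) := by
    intro s hs
    have hb : ∀ j, |s * g j| ≤ x j ∧ |s * g j| ≤ 1 - x j := by
      intro j; rw [abs_mul, hs]; exact hεx j
    refine ⟨⟨fun j => ?_, fun j => ?_⟩, ?_, fun i => ?_⟩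
    · have := (abs_le.1 (hb j).1).1
      simp only [Pi.zero_apply, Pi.add_apply, Pi.smul_apply, smul_eq_mul]; linarith
    · have := (abs_le.1 (hb j).2).2
      simp only [Pi.one_apply, Pi.add_apply, Pi.smul_apply, smul_eq_mul]; linarith
    · simp [Finset.sum_add_distrib, ← Finset.mul_sum, hsum, hgsum]
    · simp [add_mul, Finset.sum_add_distrib, mul_assoc, ← Finset.mul_sum, hbal, hgbal]
  have hseg : x ∈ openSegment ℝ (x + ε • g) (x + (-ε) • g) :=
    ⟨1 / 2, 1 / 2, by norm_num, by norm_num, by norm_num, by ext j; simp; ring⟩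
  have := hext (hmem ε (abs_of_pos hε)) (hmem (-ε) (by rw [abs_neg, abs_of_pos hε])) hseg
  apply hg0
  ext j
  have hj := congrFun this j
  simp only [Pi.add_apply, Pi.smul_apply, smul_eq_mul, add_eq_left, mul_eq_zero] at hj
  exact hj.resolve_left hε.ne'

theorem abs_sum_map_le_length_mul {β : Type*} (f : β → ℝ) (K : ℝ) (l : List β)
    (h : ∀ b ∈ l, |f b| ≤ K) : |(l.map f).sum| ≤ l.length * K := by
  induction l with
  | nil => simp
  | cons b l ih =>
    simp only [List.mem_cons, forall_eq_or_imp] at h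
    have h₁ := abs_add_le (f b) (l.map f).sum
    have h₂ := ih h.2
    simp only [List.map_cons, List.sum_cons, List.length_cons]
    push_cast
    linarith [h.1]

/-- Scaling by `(n - d) / (n + 1 - d)`, where `d = card ι`, lowers the total to the value at which
some balanced weights vanish at an index; that index can be dropped. -/
theorem exists_erase_weights [Fintype ι] [DecidableEq κ] (v : κ → ι → ℝ) (A : Finset κ) (n : ℕ)
    (hA : A.card = n + 1) (hn : Fintype.card ι ≤ n) (x : κ → ℝ)
    (hx : ∀ j ∈ A, 0 ≤ x j ∧ x j ≤ 1) (hsum : ∑ j ∈ A, x j = ((n + 1 : ℕ) : ℝ) - Fintype.card ι)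
    (hbal : ∀ i, ∑ j ∈ A, x j * v j i = 0) :
    ∃ j₀ ∈ A, ∃ y : κ → ℝ, (∀ j ∈ A.erase j₀, 0 ≤ y j ∧ y j ≤ 1) ∧
      ∑ j ∈ A.erase j₀, y j = (n : ℝ) - Fintype.card ι ∧
      ∀ i, ∑ j ∈ A.erase j₀, y j * v j i = 0 := by
  have hc : (Fintype.card A : ℝ) - 1 - Fintype.card ι = n - Fintype.card ι := by
    rw [Fintype.card_coe, hA]; push_cast; ring
  have hd : (Fintype.card ι : ℝ) ≤ n := by exact_mod_cast hn
  set d : ℝ := (Fintype.card ι : ℝ)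
  have hpos : 0 < (n : ℝ) + 1 - d := by linarith
  push_cast at hsum
  have hne : (balancedWeights (fun j : A => v j)
      ((Fintype.card A : ℝ) - 1 - Fintype.card ι)).Nonempty := by
    refine ⟨fun j => (n - d) / (n + 1 - d) * x j, ⟨fun j => ?_, fun j => ?_⟩, ?_, ?_⟩
    · exact mul_nonneg (div_nonneg (by linarith) hpos.le) (hx j j.2).1
    · have h₁ : (n - d) / (n + 1 - d) ≤ 1 := (div_le_one hpos).2 (by linarith)
      exact mul_le_one₀ h₁ (hx j j.2).1 (hx j j.2).2
    · rw [hc, ← Finset.mul_sum, Finset.sum_coe_sort A x, hsum]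
      field_simp
    · intro i
      simp only [mul_assoc]
      rw [← Finset.mul_sum, Finset.sum_coe_sort A fun j => x j * v j i, hbal, mul_zero]
  obtain ⟨y, ⟨⟨hy0, hy1⟩, hysum, hybal⟩, ⟨j₀, hj₀A⟩, hj₀⟩ :=
    exists_weight_eq_zero (fun j : A => v j) hne
  rw [hc] at hysum
  refine ⟨j₀, hj₀A, fun j => if h : j ∈ A then y ⟨j, h⟩ else 0, fun j hj => ?_, ?_, fun i => ?_⟩
  · have := Finset.mem_of_mem_erase hj
    simp only [this, dite_true]
    exact ⟨hy0 _, hy1 _⟩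
  · rw [Finset.sum_erase _ (by simp [hj₀A, hj₀]), ← hysum, ← Finset.sum_coe_sort]
    exact Finset.sum_congr rfl fun j _ => by simp
  · rw [Finset.sum_erase _ (by simp [hj₀A, hj₀]), ← hybal i, ← Finset.sum_coe_sort]
    exact Finset.sum_congr rfl fun j _ => by simp

/-- The order is built from the end: the index dropped by `exists_erase_weights` comes last. Once at
most `card ι` vectors are left, the triangle inequality suffices in any order. -/
theorem exists_prefix_bounded_list [Fintype ι] [DecidableEq κ] (v : κ → ι → ℝ) (K : ℝ)
    (hK0 : 0 ≤ K) (n : ℕ) :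
    ∀ A : Finset κ, A.card = n → (∀ j ∈ A, ∀ i, |v j i| ≤ K) →
      (n ≤ Fintype.card ι ∨ ∃ x : κ → ℝ, (∀ j ∈ A, 0 ≤ x j ∧ x j ≤ 1) ∧
        ∑ j ∈ A, x j = (n : ℝ) - Fintype.card ι ∧ ∀ i, ∑ j ∈ A, x j * v j i = 0) →
      ∃ l : List κ, l.Nodup ∧ l.toFinset = A ∧
        ∀ l₁, l₁ <+: l → ∀ i, |(l₁.map (v · i)).sum| ≤ Fintype.card ι * K := by
  induction n with
  | zero =>
    intro A hA _ _
    rw [Finset.card_eq_zero] at hA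
    subst hA
    refine ⟨[], List.nodup_nil, rfl, fun l₁ hl₁ i => ?_⟩
    rw [List.prefix_nil.1 hl₁]
    simp only [List.map_nil, List.sum_nil, abs_zero]
    positivity
  | succ n ih =>
    intro A hA hK hw
    by_cases hn : n + 1 ≤ Fintype.card ι
    · refine ⟨A.toList, A.nodup_toList, A.toList_toFinset, fun l₁ hl₁ i => ?_⟩
      refine (abs_sum_map_le_length_mul (v · i) K l₁ fun b hb =>
        hK b (Finset.mem_toList.1 (hl₁.subset hb)) i).trans ?_
      have : l₁.length ≤ Fintype.card ι := by
        have := hl₁.length_le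
        rw [Finset.length_toList, hA] at this
        omega
      gcongr
    · obtain ⟨x, hx, hsum, hbal⟩ := hw.resolve_left hn
      obtain ⟨j₀, hj₀, y, hy, hysum, hybal⟩ :=
        exists_erase_weights v A n hA (by omega) x hx hsum hbal
      obtain ⟨l, hnd, hl, hb⟩ := ih (A.erase j₀) (by rw [Finset.card_erase_of_mem hj₀, hA]; rfl)
        (fun j hj => hK j (Finset.mem_of_mem_erase hj)) (Or.inr ⟨y, hy, hysum, hybal⟩)
      have hj₀l : j₀ ∉ l := by
        rw [← List.mem_toFinset, hl]; exact Finset.notMem_erase j₀ A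
      have hnd' : (l ++ [j₀]).Nodup := by
        rw [List.nodup_append]
        refine ⟨hnd, List.nodup_singleton _, ?_⟩
        rintro a ha b hb rfl
        exact hj₀l (List.mem_singleton.1 hb ▸ ha)
      have hA' : (l ++ [j₀]).toFinset = A := by
        rw [List.toFinset_append, hl]
        ext j
        simp only [Finset.mem_union, Finset.mem_erase, List.mem_toFinset, List.mem_singleton]
        by_cases h : j = j₀ <;> simp [h, hj₀]
      refine ⟨l ++ [j₀], hnd', hA', fun l₁ hl₁ i => ?_⟩
      rw [List.prefix_concat_iff] at hl₁
      rcases hl₁ with rfl | hl₁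
      -- Subtracting the vanishing sum of `x j * v j i` leaves the coefficients `1 - x j`, which are
      -- nonnegative and have sum `card ι`.
      · have htot : ((l ++ [j₀]).map (v · i)).sum = ∑ j ∈ A, (1 - x j) * v j i := by
          rw [← List.sum_toFinset _ hnd', hA']
          simp only [sub_mul, one_mul, Finset.sum_sub_distrib, hbal, sub_zero]
        rw [htot]
        calc |∑ j ∈ A, (1 - x j) * v j i| ≤ ∑ j ∈ A, |(1 - x j) * v j i| :=
              Finset.abs_sum_le_sum_abs _ _
          _ ≤ ∑ j ∈ A, (1 - x j) * K := by
              refine Finset.sum_le_sum fun j hj => ?_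
              have : 0 ≤ 1 - x j := by linarith [(hx j hj).2]
              rw [abs_mul, abs_of_nonneg this]
              exact mul_le_mul_of_nonneg_left (hK j hj i) this
          _ = Fintype.card ι * K := by
              rw [← Finset.sum_mul, Finset.sum_sub_distrib, hsum]
              simp [hA]
      · exact hb l₁ hl₁ i

/-- The Steinitz lemma: vectors with sum zero can be rearranged so that all partial sums are
bounded in terms of the dimension and the size of the vectors. -/
theorem exists_perm_prefix_sum_bounded [Fintype ι] {β : Type*} (v : β → ι → ℝ) (K : ℝ)
    (hK0 : 0 ≤ K) (l : List β) (hK : ∀ b ∈ l, ∀ i, |v b i| ≤ K)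
    (hsum : ∀ i, (l.map (v · i)).sum = 0) :
    ∃ l' : List β, l'.Perm l ∧
      ∀ l₁, l₁ <+: l' → ∀ i, |(l₁.map (v · i)).sum| ≤ Fintype.card ι * K := by
  obtain ⟨m, hnd, hm, hb⟩ := exists_prefix_bounded_list (fun j : Fin l.length => v (l.get j)) K hK0
    l.length Finset.univ (by simp) (fun j _ => hK _ (List.get_mem l j)) (by
      rcases le_total l.length (Fintype.card ι) with h | h
      · exact Or.inl h
      · refine Or.inr ?_
        rcases Nat.eq_zero_or_pos l.length with h0 | h0
        · refine ⟨0, by simp, ?_, by simp⟩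
          have : Fintype.card ι = 0 := by omega
          simp [h0, this]
        have h0' : (0 : ℝ) < l.length := by exact_mod_cast h0
        have h' : (Fintype.card ι : ℝ) ≤ l.length := by exact_mod_cast h
        -- Constant weights balance because the vectors sum to zero.
        refine ⟨fun _ => ((l.length : ℝ) - Fintype.card ι) / l.length, fun j _ => ⟨?_, ?_⟩, ?_, ?_⟩
        · exact div_nonneg (by linarith) h0'.le
        · rw [div_le_one h0']
          have : (0 : ℝ) ≤ Fintype.card ι := by positivity
          linarith
        · simp only [Finset.sum_const, Finset.card_univ, Fintype.card_fin, nsmul_eq_mul]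
          field_simp
        · intro i
          rw [← Finset.mul_sum]
          have : ∑ j : Fin l.length, v (l.get j) i = 0 := by
            rw [← hsum i, ← List.sum_ofFn]
            congr 1
            apply List.ext_get <;> simp
          rw [this, mul_zero])
  refine ⟨m.map l.get, ?_, ?_⟩
  · have hp : m.Perm (List.finRange l.length) := by
      rw [List.perm_ext_iff_of_nodup hnd (List.nodup_finRange _)]
      intro a
      rw [← List.mem_toFinset, hm]
      simp
    have := hp.map l.get
    rwa [List.map_get_finRange] at this
  · intro l₁ hl₁ i
    obtain ⟨t, ht⟩ := hl₁
    obtain ⟨m₁, m₂, rfl, rfl, -⟩ := List.map_eq_append_iff.1 ht.symm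
    have := hb m₁ (List.prefix_append _ _) i
    simpa [List.map_map, Function.comp_def] using this

end Steinitz

/-! ### Walks and their reduction by closed walks. -/

/-- Transitions: source, letter, target. -/
abbrev Edge : Type := ℕ × ℕ × ℕ

/-- The sequence `l` of edges leads from `p` to `q`. -/
def IsWalk : ℕ → List Edge → ℕ → Prop
  | p, [], q => p = q
  | p, t :: l, q => t.1 = p ∧ IsWalk t.2.2 l q

/-- The word read along a sequence of edges. -/
def letters (l : List Edge) : List ℕ := l.map fun t => t.2.1

theorem isWalk_append {p q : ℕ} {l₁ l₂ : List Edge} :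
    IsWalk p (l₁ ++ l₂) q ↔ ∃ r, IsWalk p l₁ r ∧ IsWalk r l₂ q := by
  induction l₁ generalizing p with
  | nil => simp [IsWalk]
  | cons t l ih => simp [IsWalk, ih, and_assoc]

theorem IsWalk.append {p q r : ℕ} {l₁ l₂ : List Edge} (h₁ : IsWalk p l₁ r) (h₂ : IsWalk r l₂ q) :
    IsWalk p (l₁ ++ l₂) q :=
  isWalk_append.2 ⟨r, h₁, h₂⟩

/-- A closed walk can be inserted in front of an edge that starts at its base point. -/
theorem IsWalk.exists_insert {p q : ℕ} {l c : List Edge} {t : Edge} (h : IsWalk p l q)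
    (ht : t ∈ l) (hc : IsWalk t.1 c t.1) :
    ∃ l', IsWalk p l' q ∧ l'.Perm (c ++ l) := by
  obtain ⟨x, y, rfl⟩ := List.append_of_mem ht
  obtain ⟨r, hx, hr, hy⟩ := isWalk_append.1 h
  subst hr
  refine ⟨x ++ (c ++ t :: y), hx.append (hc.append ⟨rfl, hy⟩), ?_⟩
  rw [← List.append_assoc, ← List.append_assoc]
  exact List.perm_append_comm.append_right _

/-- By pigeonhole two edges have the same source; the segment from the first up to the second,
exclusive, is closed. -/
theorem IsWalk.exists_closed {n p q : ℕ} {l : List Edge} (h : IsWalk p l q)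
    (hn : ∀ t ∈ l, t.1 < n) (hlen : n < l.length) :
    ∃ x c y s, l = x ++ (c ++ y) ∧ c ≠ [] ∧ IsWalk s c s ∧ IsWalk p (x ++ y) q := by
  obtain ⟨i, j, hij, heq⟩ : ∃ i j : Fin l.length, i < j ∧ l[i].1 = l[j].1 := by
    obtain ⟨i, j, hij, heq⟩ := Fintype.exists_ne_map_eq_of_card_lt
      (fun i : Fin l.length => (⟨l[i].1, hn _ (l.getElem_mem i.2)⟩ : Fin n)) (by simpa using hlen)
    rcases lt_or_gt_of_ne hij with h | h
    · exact ⟨i, j, h, congrArg Fin.val heq⟩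
    · exact ⟨j, i, h, (congrArg Fin.val heq).symm⟩
  have hstart : ∀ (i : Fin l.length) {p q}, IsWalk p (l.drop i) q → p = l[i].1 := by
    intro i p q hw
    rw [List.drop_eq_getElem_cons i.2] at hw
    exact hw.1.symm
  have hdrop : l.drop i = (l.drop i).take (j - i) ++ l.drop j := by
    conv_lhs => rw [← List.take_append_drop (j - i : ℕ) (l.drop i)]
    rw [List.drop_drop]
    congr 2
    have : (i : ℕ) < j := hij
    omega
  have hsplit : l = l.take i ++ ((l.drop i).take (j - i) ++ l.drop j) := by
    rw [← hdrop, List.take_append_drop]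
  have hw := h
  rw [hsplit] at hw
  obtain ⟨s, hx, hcy⟩ := isWalk_append.1 hw
  have hs : s = l[i].1 := hstart i (by rw [hdrop]; exact hcy)
  obtain ⟨s', hc, hy⟩ := isWalk_append.1 hcy
  have hs' : s' = l[j].1 := hstart j hy
  have hss : s' = s := by rw [hs, hs', heq]
  subst hss
  refine ⟨_, _, _, s', hsplit, ?_, hc, hx.append hy⟩
  intro h0
  have := congrArg List.length h0
  simp only [List.length_take, List.length_drop, List.length_nil] at this
  have h1 : (i : ℕ) < j := hij
  have h2 := j.2
  omega

/-- The walk is processed edge by edge. The part `x` contains every edge seen so far, and `y` is a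
tail made of old edges. A new edge makes `x` absorb the tail and that edge, at most `n + 1` edges;
this happens once per distinct edge. An old edge extends the tail, and as soon as the tail has
length `n + 1` a closed walk is cut out of it. Its edges stay in `x`, so it can be reinserted later.
-/
theorem IsWalk.exists_reduction_aux {n p q : ℕ} {l : List Edge} (h : IsWalk p l q)
    (hn : ∀ t ∈ l, t.1 < n) :
    ∃ (x y : List Edge) (cs : List (List Edge)), IsWalk p (x ++ y) q ∧
      l.Perm (x ++ y ++ cs.flatten) ∧ y ⊆ x ∧ y.length ≤ n ∧
      x.length ≤ x.toFinset.card * (n + 1) ∧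
      ∀ c ∈ cs, c.length ≤ n + 1 ∧ c ≠ [] ∧ c ⊆ x ∧ ∃ s, IsWalk s c s := by
  induction l using List.reverseRecOn generalizing q with
  | nil => exact ⟨[], [], [], h, by simp, by simp, by simp, by simp, by simp⟩
  | append_singleton l t ih =>
    obtain ⟨r, hl, ht⟩ := isWalk_append.1 h
    obtain ⟨x, y, cs, hw, hp, hyx, hy, hx, hcs⟩ :=
      ih hl fun t ht => hn t (List.mem_append_left _ ht)
    have hw' : IsWalk p (x ++ (y ++ [t])) q := by
      rw [← List.append_assoc]; exact hw.append ht
    have hp' : (l ++ [t]).Perm (x ++ (y ++ [t]) ++ cs.flatten) := by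
      have h₁ := hp.append_right [t]
      refine h₁.trans ?_
      simp only [List.append_assoc]
      exact (List.perm_append_comm.append_left _).append_left _
    by_cases htx : t ∈ x
    · have hyx' : y ++ [t] ⊆ x := by
        intro a ha
        rcases List.mem_append.1 ha with h | h
        · exact hyx h
        · rw [List.mem_singleton.1 h]; exact htx
      by_cases hlen : (y ++ [t]).length ≤ n
      · exact ⟨x, y ++ [t], cs, hw', hp', hyx', hlen, hx, hcs⟩
      · obtain ⟨r', hx', hy'⟩ := isWalk_append.1 hw'
        obtain ⟨y₁, c, y₂, s, hyc, hc0, hc, hyw⟩ := hy'.exists_closed (n := n)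
          (fun a ha => hn a (hp'.mem_iff.2 (by simp only [List.mem_append] at ha ⊢; tauto)))
          (by omega)
        have hlen' : (y ++ [t]).length = n + 1 := by
          simp only [List.length_append, List.length_singleton] at hlen ⊢; omega
        have hlc := congrArg List.length hyc
        rw [hlen'] at hlc
        simp only [List.length_append] at hlc
        have hcpos := List.length_pos_iff.2 hc0
        rw [hyc] at hyx' hp'
        refine ⟨x, y₁ ++ y₂, c :: cs, hx'.append hyw, ?_, ?_, ?_, hx, ?_⟩
        · refine hp'.trans ?_
          simp only [List.flatten_cons, List.append_assoc]
          refine (List.Perm.append_left _ ?_).append_left _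
          rw [← List.append_assoc, ← List.append_assoc]
          exact List.perm_append_comm.append_right _
        · intro a ha
          apply hyx'
          simp only [List.mem_append] at ha ⊢
          tauto
        · simp only [List.length_append]; omega
        · intro c' hc'
          rcases List.mem_cons.1 hc' with rfl | hc'
          · refine ⟨by omega, hc0, fun a ha => hyx' ?_, s, hc⟩
            simp only [List.mem_append]; tauto
          · exact hcs c' hc'
    · refine ⟨x ++ (y ++ [t]), [], cs, by simpa using hw', by simpa using hp', by simp, by simp,
        ?_, ?_⟩
      · have : (x ++ (y ++ [t])).toFinset = insert t x.toFinset := by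
          ext a
          simp only [List.mem_toFinset, List.mem_append, List.mem_singleton, Finset.mem_insert]
          have := @hyx a
          tauto
        rw [this, Finset.card_insert_of_notMem (by simpa using htx)]
        simp only [List.length_append, List.length_singleton, add_mul]
        omega
      · intro c hc
        obtain ⟨h1, h2, h3, h4⟩ := hcs c hc
        exact ⟨h1, h2, List.Subset.trans h3 (List.subset_append_left _ _), h4⟩

/-- A bound for the length of reduced walks in a graph with vertices below `n` and `m` edges. -/
def walkBound (n m : ℕ) : ℕ := (m + 1) * (n + 1) + n

/-- Every walk is a rearrangement of a short walk with the same edges together with short closed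
walks that start on the short walk. -/
theorem IsWalk.exists_reduction {n p q : ℕ} {l E : List Edge} (h : IsWalk p l q)
    (hn : ∀ t ∈ E, t.1 < n) (hE : l ⊆ E) :
    ∃ (l₀ : List Edge) (cs : List (List Edge)), IsWalk p l₀ q ∧ l.Perm (l₀ ++ cs.flatten) ∧
      l₀.length ≤ walkBound n E.length ∧ l ⊆ l₀ ∧ l₀ ⊆ l ∧
      ∀ c ∈ cs, c.length ≤ walkBound n E.length ∧ c ⊆ E ∧ ∃ t ∈ l₀, IsWalk t.1 c t.1 := by
  obtain ⟨x, y, cs, hw, hp, hyx, hy, hx, hcs⟩ := h.exists_reduction_aux fun t ht => hn t (hE ht)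
  have hsub : x ++ y ⊆ l := fun a ha => hp.mem_iff.2 (List.mem_append_left _ ha)
  have hcard : x.toFinset.card ≤ E.length := by
    refine le_trans (Finset.card_le_card ?_) (List.toFinset_card_le E)
    intro a ha
    simp only [List.mem_toFinset] at ha ⊢
    exact hE (hsub (List.mem_append_left _ ha))
  have hx' : x.length ≤ E.length * (n + 1) := hx.trans (Nat.mul_le_mul_right _ hcard)
  refine ⟨x ++ y, cs, hw, hp, ?_, ?_, hsub, ?_⟩
  · simp only [walkBound, List.length_append, add_mul]; omega
  · intro a ha
    rcases List.mem_append.1 (hp.mem_iff.1 ha) with h | h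
    · exact h
    · obtain ⟨c, hc, hac⟩ := List.mem_flatten.1 h
      exact List.mem_append_left _ ((hcs c hc).2.2.1 hac)
  · intro c hc
    obtain ⟨h1, h2, h3, s, h4⟩ := hcs c hc
    refine ⟨?_, fun a ha => hE (hsub (List.mem_append_left _ (h3 ha))), ?_⟩
    · simp only [walkBound, add_mul]; omega
    · obtain ⟨t, c', rfl⟩ := List.exists_cons_of_ne_nil h2
      have : t.1 = s := h4.1
      subst this
      exact ⟨t, List.mem_append_left _ (h3 List.mem_cons_self), h4⟩

/-! ### Acceptance up to permutation in terms of finite walks. -/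

namespace AutomatonCode

/-- The meaningful transitions of a description. -/
def edges (k : ℕ) (c : AutomatonCode) : List Edge :=
  c.transitions.filter fun t => t.1 < c.numStates ∧ t.2.1 < k ∧ t.2.2 < c.numStates

/-- The meaningful initial states of a description. -/
def starts (c : AutomatonCode) : List ℕ :=
  c.initial.filter fun p => p < c.numStates

theorem mem_edges {k : ℕ} {c : AutomatonCode} {t : Edge} :
    t ∈ edges k c ↔ t ∈ c.transitions ∧ t.1 < c.numStates ∧ t.2.1 < k ∧ t.2.2 < c.numStates := by
  simp [edges]

theorem mem_starts {c : AutomatonCode} {p : ℕ} :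
    p ∈ starts c ↔ p ∈ c.initial ∧ p < c.numStates := by
  simp [starts]

/-- Acceptance of the Parikh image that is infinite on `S` and given by `v` elsewhere, in terms of
finite walks: a walk to an accepting state, and a closed walk there that reads exactly the letters
in `S`. -/
def Accepts (k : ℕ) (c : AutomatonCode) (S : List ℕ) (v : ℕ → ℕ) : Prop :=
  ∃ p ∈ starts c, ∃ q ∈ c.accepting, ∃ l r : List Edge, l ⊆ edges k c ∧ r ⊆ edges k c ∧
    IsWalk p l q ∧ IsWalk q r q ∧ (∀ a, a ∈ letters r ↔ a ∈ S) ∧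
    ∀ a ∉ S, (letters l).count a = v a

end AutomatonCode

open AutomatonCode

theorem encard_lt_and_eq {β : Type*} [DecidableEq β] (f : ℕ → β) (b : β) (n : ℕ) :
    {i | i < n ∧ f i = b}.encard = ((List.range n).map f).count b := by
  have h : ((Finset.range n).filter fun i => f i = b).card = ((List.range n).map f).count b := by
    induction n with
    | zero => simp
    | succ n ih =>
      rw [List.range_succ, List.map_append, List.count_append, ← ih, Finset.range_add_one,
        Finset.filter_insert]
      by_cases hb : f n = b
      · simp [hb]
      · simp [hb]
  rw [← h, ← Set.encard_coe_eq_coe_finsetCard]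
  congr 1
  ext i
  simp

theorem isWalk_range' {t : ℕ → Edge} (ht : ∀ i, (t i).2.2 = (t (i + 1)).1) (i n : ℕ) :
    IsWalk (t i).1 ((List.range' i n).map t) (t (i + n)).1 := by
  induction n generalizing i with
  | zero => simp [IsWalk]
  | succ n ih =>
    rw [List.range'_succ, List.map_cons]
    refine ⟨rfl, ?_⟩
    have := ih (i + 1)
    rw [ht i]
    convert this using 3
    ring

theorem IsWalk.target_getElem {p q : ℕ} {l : List Edge} (h : IsWalk p l q) (i : ℕ)
    (hi : i < l.length) : l[i].2.2 = if h : i + 1 < l.length then l[i + 1].1 else q := by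
  induction l generalizing p i with
  | nil => simp at hi
  | cons t l ih =>
    cases i with
    | zero =>
      cases l with
      | nil => simpa [IsWalk] using h.2
      | cons t' l => simpa using h.2.1.symm
    | succ i =>
      have := ih h.2 i (by simpa using hi)
      simpa using this

theorem IsWalk.source_getElem_zero {p q : ℕ} {l : List Edge} (h : IsWalk p l q)
    (hl : 0 < l.length) : l[0].1 = p := by
  cases l with
  | nil => simp at hl
  | cons t l => exact h.1

/-- The sequence of edges that follows `l` and then repeats `r` forever. -/
def lasso (l r : List Edge) (hr : 0 < r.length) (i : ℕ) : Edge :=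
  if h : i < l.length then l[i] else r[(i - l.length) % r.length]'(Nat.mod_lt _ hr)

theorem lasso_of_lt {l r : List Edge} (hr : 0 < r.length) {i : ℕ} (h : i < l.length) :
    lasso l r hr i = l[i] := by
  simp [lasso, h]

theorem lasso_add {l r : List Edge} (hr : 0 < r.length) (i j : ℕ) (hi : i < r.length) :
    lasso l r hr (l.length + (i + r.length * j)) = r[i] := by
  simp [lasso, Nat.mod_eq_of_lt hi]

theorem lasso_mem {l r : List Edge} (hr : 0 < r.length) (i : ℕ) :
    lasso l r hr i ∈ l ∨ l.length ≤ i ∧ lasso l r hr i ∈ r := by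
  unfold lasso
  split_ifs with h
  · exact Or.inl (List.getElem_mem _)
  · exact Or.inr ⟨by omega, List.getElem_mem _⟩

theorem lasso_zero {p q : ℕ} {l r : List Edge} (hr : 0 < r.length) (hl : IsWalk p l q)
    (hrw : IsWalk q r q) : (lasso l r hr 0).1 = p := by
  cases l with
  | nil =>
    have : p = q := hl
    subst this
    simpa [lasso] using hrw.source_getElem_zero hr
  | cons t l => simpa [lasso] using hl.1

theorem lasso_chain {p q : ℕ} {l r : List Edge} (hr : 0 < r.length) (hl : IsWalk p l q)
    (hrw : IsWalk q r q) (i : ℕ) : (lasso l r hr i).2.2 = (lasso l r hr (i + 1)).1 := by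
  have hq := hrw.source_getElem_zero hr
  rcases Nat.lt_or_ge i l.length with hi | hi
  · rw [lasso_of_lt hr hi, hl.target_getElem i hi]
    split_ifs with h
    · rw [lasso_of_lt hr h]
    · have : i + 1 = l.length + (0 + r.length * 0) := by omega
      rw [this, lasso_add hr 0 0 hr, hq]
  · obtain ⟨m, j, hm, rfl⟩ : ∃ m j, m < r.length ∧ i = l.length + (m + r.length * j) :=
      ⟨(i - l.length) % r.length, (i - l.length) / r.length, Nat.mod_lt _ hr, by
        rw [Nat.mod_add_div]; omega⟩
    rw [lasso_add hr m j hm, hrw.target_getElem m hm]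
    split_ifs with h
    · have : l.length + (m + r.length * j) + 1 = l.length + ((m + 1) + r.length * j) := by ring
      rw [this, lasso_add hr (m + 1) j h]
    · have : l.length + (m + r.length * j) + 1 = l.length + (0 + r.length * (j + 1)) := by
        have : m + 1 = r.length := by omega
        rw [mul_add, mul_one]; omega
      rw [this, lasso_add hr 0 (j + 1) hr, hq]

theorem infinite_lasso {l r : List Edge} (hr : 0 < r.length) (P : Edge → Prop) (t : Edge)
    (ht : t ∈ r) (hP : P t) : {i | P (lasso l r hr i)}.Infinite := by
  obtain ⟨m, hm, rfl⟩ := List.getElem_of_mem ht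
  refine Set.infinite_of_injective_forall_mem (f := fun j => l.length + (m + r.length * j)) ?_ ?_
  · intro j j' h
    have : r.length * j = r.length * j' := by simpa using h
    exact Nat.eq_of_mul_eq_mul_left hr this
  · intro j
    simpa [lasso_add hr m j hm] using hP

section Parikh

variable {α : Type*} {Q : Type*} {k : ℕ} {c : AutomatonCode} {e : α ≃ Fin k} {A : NFA α Q}
  {w : ℕ → α} {S : List ℕ} {v : ℕ → ℕ}

theorem parikh_eq_top {a : α} : parikh w a = ⊤ ↔ {i | w i = a}.Infinite := by
  simp [parikh, Set.encard_eq_top_iff]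

theorem exists_forall_ge_parikh_eq_top [Finite α] (w : ℕ → α) :
    ∃ N, ∀ i ≥ N, parikh w (w i) = ⊤ := by
  have hfin : (⋃ a ∈ {a | parikh w a ≠ ⊤}, {i | w i = a}).Finite := by
    refine Set.Finite.biUnion (Set.toFinite _) fun a ha => ?_
    by_contra h
    exact ha (parikh_eq_top.2 h)
  obtain ⟨N, hN⟩ := hfin.bddAbove
  refine ⟨N + 1, fun i hi => ?_⟩
  by_contra h
  have : i ≤ N := hN (by simp only [Set.mem_iUnion]; exact ⟨w i, h, rfl⟩)
  omega

/-- An accepting run is cut at two visits `i₀ < i₁` to the same accepting state: `i₀` comes after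
all occurrences of the finite letters, and every infinite letter occurs between the two. -/
theorem accepts_of_mem_jumpingLanguage (hc : c.Describes e A)
    (hS : ∀ a, (e a : ℕ) ∈ S ↔ parikh w a = ⊤) (hSk : ∀ i ∈ S, i < k)
    (hv : ∀ a, parikh w a ≠ ⊤ → parikh w a = v (e a)) (hvk : ∀ i, k ≤ i → v i = 0)
    (h : w ∈ jumpingLanguage A) : Accepts k c S v := by
  obtain ⟨w', hw', ρ, ⟨hρ0, hρ⟩, q, hqinf, hqacc⟩ := h
  obtain ⟨g, hstep, hstart, hacc⟩ := hc
  have : Finite α := Finite.of_equiv _ e.symm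
  rw [← hw'] at hS hv
  obtain ⟨N, hN⟩ := exists_forall_ge_parikh_eq_top w'
  obtain ⟨i₀, hi₀, hq₀⟩ := hqinf N
  -- The premise stands inside the existential so that `occ` is defined on all letters; its values
  -- at finite letters are irrelevant.
  have hocc : ∀ a, ∃ i, parikh w' a = ⊤ → i₀ ≤ i ∧ w' i = a := by
    intro a
    by_cases ha : parikh w' a = ⊤
    · obtain ⟨i, hi, hlt⟩ := (parikh_eq_top.1 ha).exists_gt i₀
      exact ⟨i, fun _ => ⟨hlt.le, hi⟩⟩
    · exact ⟨0, fun h => absurd h ha⟩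
  choose occ hocc using hocc
  obtain ⟨J, hJ⟩ := (Set.finite_range occ).bddAbove
  obtain ⟨i₁, hi₁, hq₁⟩ := hqinf (max J i₀)
  have hi₀₁ : i₀ < i₁ := lt_of_le_of_lt (le_max_right _ _) hi₁
  let t : ℕ → Edge := fun i => ((g (ρ i) : ℕ), (e (w' i) : ℕ), (g (ρ (i + 1)) : ℕ))
  have htE : ∀ i, t i ∈ edges k c := fun i =>
    mem_edges.2 ⟨(hstep _ _ _).1 (hρ i), (g (ρ i)).2, (e (w' i)).2, (g (ρ (i + 1))).2⟩
  have ht : ∀ i, (t i).2.2 = (t (i + 1)).1 := fun i => rfl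
  refine ⟨g (ρ 0), mem_starts.2 ⟨(hstart _).1 hρ0, (g (ρ 0)).2⟩, g q, (hacc q).1 hqacc,
    (List.range i₀).map t, (List.range' i₀ (i₁ - i₀)).map t, ?_, ?_, ?_, ?_, ?_, ?_⟩
  · intro x hx
    obtain ⟨i, -, rfl⟩ := List.mem_map.1 hx
    exact htE i
  · intro x hx
    obtain ⟨i, -, rfl⟩ := List.mem_map.1 hx
    exact htE i
  · have := isWalk_range' ht 0 i₀
    rw [List.range_eq_range']
    simpa [t, hq₀] using this
  · have := isWalk_range' ht i₀ (i₁ - i₀)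
    rw [Nat.add_sub_cancel' hi₀₁.le] at this
    simpa only [t, hq₀, hq₁] using this
  · intro b
    simp only [letters, List.map_map, List.mem_map, List.mem_range'_1, Function.comp_apply, t]
    constructor
    · rintro ⟨i, hi, rfl⟩
      exact (hS _).2 (hN i (by omega))
    · intro hb
      obtain ⟨a, ha⟩ := e.surjective ⟨b, hSk b hb⟩
      have hb' : (e a : ℕ) = b := by rw [ha]
      have htop := (hS a).1 (hb' ▸ hb)
      refine ⟨occ a, ⟨(hocc a htop).1, ?_⟩, by rw [(hocc a htop).2, hb']⟩
      have : occ a ≤ J := hJ ⟨a, rfl⟩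
      have := le_max_left J i₀
      omega
  · intro b hb
    rcases Nat.lt_or_ge b k with hbk | hbk
    · obtain ⟨a, ha⟩ := e.surjective ⟨b, hbk⟩
      have hb' : (e a : ℕ) = b := by rw [ha]
      have hfin : parikh w' a ≠ ⊤ := fun h => hb (hb' ▸ (hS a).2 h)
      have h1 := hv a hfin
      rw [hb'] at h1
      have h2 : {i | w' i = a} = {i | i < i₀ ∧ (e (w' i) : ℕ) = b} := by
        ext i
        simp only [Set.mem_ofPred_eq]
        constructor
        · rintro rfl
          refine ⟨?_, hb'⟩
          by_contra hlt
          exact hfin (hN i (by omega))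
        · rintro ⟨-, h⟩
          rw [← hb'] at h
          exact e.injective (Fin.ext h)
      unfold parikh at h1
      rw [h2, encard_lt_and_eq] at h1
      have := ENat.natCast_inj.1 h1
      simpa [letters, t, Function.comp_def] using this
    · rw [hvk b hbk, List.count_eq_zero]
      intro hmem
      simp only [letters, List.map_map, List.mem_map, Function.comp_apply, t] at hmem
      obtain ⟨i, -, rfl⟩ := hmem
      exact absurd (e (w' i)).2 (by omega)

/-- The lasso formed by the two walks is an accepting run: the loop supplies the letters of `S`
infinitely often and no others, so the remaining counts come from the stem. -/
theorem mem_jumpingLanguage_of_accepts (hc : c.Describes e A)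
    (hS : ∀ a, (e a : ℕ) ∈ S ↔ parikh w a = ⊤)
    (hv : ∀ a, parikh w a ≠ ⊤ → parikh w a = v (e a))
    (h : Accepts k c S v) : w ∈ jumpingLanguage A := by
  obtain ⟨p, hp, q, hq, l, r, hlE, hrE, hl, hr, hrS, hlv⟩ := h
  obtain ⟨g, hstep, hstart, hacc⟩ := hc
  have : Finite α := Finite.of_equiv _ e.symm
  obtain ⟨hp, hpn⟩ := mem_starts.1 hp
  -- An infinite word over a finite alphabet repeats some letter forever, so `S`, and with it the
  -- loop, is nonempty.
  have hr0 : 0 < r.length := by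
    obtain ⟨N, hN⟩ := exists_forall_ge_parikh_eq_top w
    have h1 := (hrS _).2 ((hS _).2 (hN N le_rfl))
    obtain ⟨t, ht, -⟩ := List.mem_map.1 h1
    exact List.length_pos_of_mem ht
  let t := lasso l r hr0
  have htE : ∀ i, t i ∈ edges k c := fun i =>
    (lasso_mem hr0 i).elim (fun h => hlE h) (fun h => hrE h.2)
  have hb := fun i => mem_edges.1 (htE i)
  let ρ : ℕ → Q := fun i => g.symm ⟨(t i).1, (hb i).2.1⟩
  let w' : ℕ → α := fun i => e.symm ⟨(t i).2.1, (hb i).2.2.1⟩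
  have hρ : ∀ i, (g (ρ i) : ℕ) = (t i).1 := fun i => by simp [ρ]
  have hw' : ∀ i, (e (w' i) : ℕ) = (t i).2.1 := fun i => by simp [w']
  have hw'a : ∀ i a, w' i = a ↔ (t i).2.1 = e a := fun i a => by
    rw [← hw']
    exact ⟨fun h => by rw [h], fun h => e.injective (Fin.ext h)⟩
  refine ⟨w', ?_, ρ, ⟨?_, fun i => ?_⟩, g.symm ⟨q, ?_⟩, ?_, ?_⟩
  · funext a
    by_cases ha : parikh w a = ⊤
    · rw [ha, parikh_eq_top]
      obtain ⟨x, hx, hxa⟩ := List.mem_map.1 ((hrS _).2 ((hS a).2 ha))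
      simp only [hw'a]
      exact infinite_lasso hr0 (fun x => x.2.1 = e a) x hx hxa
    · have haS : (e a : ℕ) ∉ S := fun h => ha ((hS a).1 h)
      rw [hv a ha, ← hlv _ haS]
      have h1 : {i | w' i = a} = {i | i < l.length ∧ (t i).2.1 = e a} := by
        ext i
        simp only [Set.mem_ofPred_eq, hw'a]
        refine ⟨fun h => ⟨?_, h⟩, fun h => h.2⟩
        by_contra hlt
        have hir : t i ∈ r := by
          simp only [t, lasso, hlt, dite_false]
          exact List.getElem_mem _
        exact haS ((hrS _).1 (List.mem_map.2 ⟨t i, hir, h⟩))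
      rw [parikh, h1, encard_lt_and_eq]
      congr 2
      apply List.ext_getElem
      · simp [letters]
      · intro i h1 h2
        have hi : i < l.length := by simpa using h1
        simp [letters, t, lasso_of_lt hr0 hi]
  · rw [hstart, hρ, lasso_zero hr0 hl hr]
    exact hp
  · rw [hstep, hρ, hw', hρ, ← lasso_chain hr0 hl hr i]
    exact (hb i).1
  · rw [← hr.source_getElem_zero hr0]
    exact (mem_edges.1 (hrE (List.getElem_mem _))).2.1
  · intro i
    refine ⟨l.length + (0 + r.length * (i + 1)), ?_, ?_⟩
    · have : i + 1 ≤ r.length * (i + 1) := Nat.le_mul_of_pos_left _ hr0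
      omega
    · apply g.injective
      apply Fin.ext
      rw [hρ]
      simp only [t, lasso_add hr0 0 (i + 1) hr0, hr.source_getElem_zero hr0,
        Equiv.apply_symm_apply]
  · rw [hacc]
    simpa using hq

end Parikh

/-! ### Automata presented by a list of structured states. -/

/-- The lists of length at most `n` with entries in `E`. -/
def boundedLists {τ : Type*} (E : List τ) : ℕ → List (List τ)
  | 0 => [[]]
  | n + 1 => [] :: E.flatMap fun t => (boundedLists E n).map (List.cons t)

theorem mem_boundedLists {τ : Type*} {E : List τ} {n : ℕ} {l : List τ} :
    l ∈ boundedLists E n ↔ l.length ≤ n ∧ l ⊆ E := by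
  induction n generalizing l with
  | zero => simp +contextual [boundedLists]
  | succ n ih =>
    cases l with
    | nil => simp [boundedLists]
    | cons t l =>
      simp only [boundedLists, List.mem_cons, reduceCtorEq, List.mem_flatMap, List.mem_map,
        List.cons.injEq, false_or, List.length_cons, List.cons_subset]
      constructor
      · rintro ⟨_, ht, _, hl, rfl, rfl⟩
        have := ih.1 hl
        exact ⟨by omega, ht, this.2⟩
      · rintro ⟨h, ht, hl⟩
        exact ⟨t, ht, l, ih.2 ⟨by omega, hl⟩, rfl, rfl⟩

section CodeOf

variable {σ : Type*}

/-- The word `x` can be read on a path from `s` to `s'` through states in `L`. -/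
def Reads (L : List σ) (R : σ → ℕ → σ → Prop) : σ → List ℕ → σ → Prop
  | s, [], s' => s = s'
  | s, a :: x, s' => ∃ m ∈ L, R s a m ∧ Reads L R m x s'

theorem Reads.append {L : List σ} {R : σ → ℕ → σ → Prop} {s m s' : σ} {x y : List ℕ}
    (h₁ : Reads L R s x m) (h₂ : Reads L R m y s') : Reads L R s (x ++ y) s' := by
  induction x generalizing s with
  | nil => cases h₁; exact h₂
  | cons a x ih =>
    obtain ⟨n, hn, hR, h⟩ := h₁
    exact ⟨n, hn, hR, ih h⟩

variable [Inhabited σ]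

open Classical in
/-- The description of the automaton with states listed by `L`, alphabet size `k`, transition
relation `R`, initial states `I` and accepting states `F`. -/
noncomputable def codeOf (k : ℕ) (L : List σ) (R : σ → ℕ → σ → Prop) (I F : σ → Prop) :
    AutomatonCode :=
  (L.length,
    (List.range L.length ×ˢ (List.range k ×ˢ List.range L.length)).filter
      (fun t => R (L.getD t.1 default) t.2.1 (L.getD t.2.2 default)),
    (List.range L.length).filter (fun i => I (L.getD i default)),
    (List.range L.length).filter (fun i => F (L.getD i default)))

theorem mem_edges_codeOf {k : ℕ} {L : List σ} {R : σ → ℕ → σ → Prop} {I F : σ → Prop} {t : Edge} :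
    t ∈ edges k (codeOf k L R I F) ↔ (t.1 < L.length ∧ t.2.1 < k ∧ t.2.2 < L.length) ∧
      R (L.getD t.1 default) t.2.1 (L.getD t.2.2 default) := by
  obtain ⟨i, a, j⟩ := t
  simp [mem_edges, codeOf, numStates, transitions]
  tauto

theorem mem_starts_codeOf {k : ℕ} {L : List σ} {R : σ → ℕ → σ → Prop} {I F : σ → Prop} {i : ℕ} :
    i ∈ starts (codeOf k L R I F) ↔ i < L.length ∧ I (L.getD i default) := by
  simp [mem_starts, codeOf, numStates, initial]
  tauto

theorem mem_accepting_codeOf {k : ℕ} {L : List σ} {R : σ → ℕ → σ → Prop} {I F : σ → Prop} {i : ℕ} :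
    i ∈ (codeOf k L R I F).accepting ↔ i < L.length ∧ F (L.getD i default) := by
  simp [codeOf, accepting]

theorem getD_mem {L : List σ} {i : ℕ} (hi : i < L.length) : L.getD i default ∈ L := by
  rw [List.getD_eq_getElem _ _ hi]
  exact List.getElem_mem hi

theorem reads_of_isWalk {k : ℕ} {L : List σ} {R : σ → ℕ → σ → Prop} {I F : σ → Prop} {i j : ℕ}
    {l : List Edge} (hl : l ⊆ edges k (codeOf k L R I F)) (h : IsWalk i l j) :
    Reads L R (L.getD i default) (letters l) (L.getD j default) := by
  induction l generalizing i with
  | nil => cases h; rfl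
  | cons t l ih =>
    obtain ⟨rfl, h⟩ := h
    rw [List.cons_subset] at hl
    obtain ⟨⟨-, -, h3⟩, hR⟩ := mem_edges_codeOf.1 hl.1
    exact ⟨_, getD_mem h3, hR, ih hl.2 h⟩

theorem getD_idxOf [DecidableEq σ] {L : List σ} {s : σ} (hs : s ∈ L) :
    L.getD (L.idxOf s) default = s := by
  rw [List.getD_eq_getElem _ _ (List.idxOf_lt_length_of_mem hs)]
  simp

theorem Reads.exists_isWalk [DecidableEq σ] {k : ℕ} {L : List σ} {R : σ → ℕ → σ → Prop}
    {I F : σ → Prop} {s s' : σ} {x : List ℕ} (h : Reads L R s x s') (hs : s ∈ L)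
    (hx : ∀ a ∈ x, a < k) :
    ∃ l, l ⊆ edges k (codeOf k L R I F) ∧ IsWalk (L.idxOf s) l (L.idxOf s') ∧ letters l = x := by
  induction x generalizing s with
  | nil => cases h; exact ⟨[], by simp, rfl, rfl⟩
  | cons a x ih =>
    obtain ⟨m, hm, hR, h⟩ := h
    obtain ⟨l, hl, hw, hlx⟩ := ih h hm fun b hb => hx b (List.mem_cons_of_mem _ hb)
    refine ⟨(L.idxOf s, a, L.idxOf m) :: l, ?_, ⟨rfl, hw⟩, ?_⟩
    · rw [List.cons_subset]
      refine ⟨mem_edges_codeOf.2 ⟨⟨List.idxOf_lt_length_of_mem hs, hx a List.mem_cons_self,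
        List.idxOf_lt_length_of_mem hm⟩, ?_⟩, hl⟩
      rw [getD_idxOf hs, getD_idxOf hm]
      exact hR
    · rw [← hlx]; rfl

theorem lt_of_mem_letters {k : ℕ} {c : AutomatonCode} {l : List Edge} (hl : l ⊆ edges k c) {a : ℕ}
    (ha : a ∈ letters l) : a < k := by
  obtain ⟨t, ht, rfl⟩ := List.mem_map.1 ha
  exact (mem_edges.1 (hl ht)).2.2.1

theorem IsWalk.lt_of_subset_edges {k : ℕ} {c : AutomatonCode} {p q : ℕ} {l : List Edge}
    (h : IsWalk p l q) (hl : l ⊆ edges k c) (hp : p < c.numStates) : q < c.numStates := by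
  induction l generalizing p with
  | nil => cases h; exact hp
  | cons t l ih =>
    rw [List.cons_subset] at hl
    exact ih h.2 hl.2 (mem_edges.1 hl.1).2.2.2

/-- This removes the numbering of states from all later arguments. The list `L` may have
repetitions: a path of states is lifted to walks through first indices. -/
theorem accepts_codeOf {k : ℕ} {L : List σ} {R : σ → ℕ → σ → Prop} {I F : σ → Prop}
    {S : List ℕ} {v : ℕ → ℕ} :
    Accepts k (codeOf k L R I F) S v ↔ ∃ s ∈ L, I s ∧ ∃ s' ∈ L, F s' ∧ ∃ x r : List ℕ,
      (∀ a ∈ x, a < k) ∧ (∀ a ∈ r, a < k) ∧ Reads L R s x s' ∧ Reads L R s' r s' ∧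
      (∀ a, a ∈ r ↔ a ∈ S) ∧ ∀ a ∉ S, x.count a = v a := by
  classical
  constructor
  · rintro ⟨i, hi, j, hj, l, r, hl, hr, hlw, hrw, hrS, hv⟩
    obtain ⟨hi, hI⟩ := mem_starts_codeOf.1 hi
    obtain ⟨hj, hF⟩ := mem_accepting_codeOf.1 hj
    exact ⟨_, getD_mem hi, hI, _, getD_mem hj, hF, letters l, letters r,
      fun a => lt_of_mem_letters hl, fun a => lt_of_mem_letters hr, reads_of_isWalk hl hlw,
      reads_of_isWalk hr hrw, hrS, hv⟩
  · rintro ⟨s, hs, hI, s', hs', hF, x, r, hx, hr, hxR, hrR, hrS, hv⟩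
    obtain ⟨l₁, hl₁, hw₁, rfl⟩ := hxR.exists_isWalk (I := I) (F := F) hs hx
    obtain ⟨l₂, hl₂, hw₂, rfl⟩ := hrR.exists_isWalk (I := I) (F := F) hs' hr
    refine ⟨_, mem_starts_codeOf.2 ⟨List.idxOf_lt_length_of_mem hs, ?_⟩, _,
      mem_accepting_codeOf.2 ⟨List.idxOf_lt_length_of_mem hs', ?_⟩, l₁, l₂, hl₁, hl₂, hw₁, hw₂,
      hrS, hv⟩
    · rwa [getD_idxOf hs]
    · rwa [getD_idxOf hs']

end CodeOf

/-! ### The intersection automaton. -/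

/-- What the intersection automaton remembers about one of the two automata: the last vertex of a
walk, the walk, and the vector of letters that are still to be read. -/
abbrev SideState : Type := ℕ × List Edge × List ℕ

/-- The states of the intersection automaton: the letters to be read infinitely often, the rest of
them to be read in the current round (empty before the first round), and the two sides. -/
abbrev JointState : Type := List ℕ × List ℕ × SideState × SideState

section Side

variable (k B M : ℕ) (c : AutomatonCode) (S : List ℕ)

/-- `y` differs from `x` by the additional pending letters `z`, up to letters in `S`. -/
def Shift (z : List ℕ) (x y : SideState) : Prop :=
  y.1 = x.1 ∧ y.2.1 = x.2.1 ∧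
    ∀ b ∈ List.range k, b ∈ S ∨ y.2.2.getD b 0 = x.2.2.getD b 0 + z.count b

/-- `y` arises from `x` by attaching a closed walk to the walk of `x`. -/
def Pumps (x y : SideState) : Prop :=
  ∃ l ∈ boundedLists (edges k c) B, (∃ t ∈ x.2.1, IsWalk t.1 l t.1) ∧ Shift k S (letters l) x y

/-- The walk of `x` starts in an initial state, and its letters are pending (with offset `M`). -/
def Begins (x : SideState) : Prop :=
  (∃ p ∈ starts c, IsWalk p x.2.1 x.1) ∧
    ∀ b ∈ List.range k, b ∈ S ∨ x.2.2.getD b 0 = M + (letters x.2.1).count b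

/-- No letters are pending in `x` (up to the offset `M`), and the walk of `x` ends in an accepting
state with a closed walk that reads exactly the letters in `S`. -/
def Finishes (x : SideState) : Prop :=
  x.1 ∈ c.accepting ∧ (∀ b ∈ List.range k, b ∈ S ∨ x.2.2.getD b 0 = M) ∧
    ∃ r ∈ boundedLists (edges k c) B, IsWalk x.1 r x.1 ∧
      (∀ a ∈ S, a ∈ letters r) ∧ ∀ a ∈ letters r, a ∈ S

/-- All side states for walks of length at most `B` and entries of the vector at most `2 * M`. -/
def sideStates : List SideState :=
  List.range c.numStates ×ˢ (boundedLists (edges k c) B ×ˢ boundedLists (List.range (2 * M + 1)) k)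

end Side

theorem mem_sideStates {k B M : ℕ} {c : AutomatonCode} {x : SideState} :
    x ∈ sideStates k B M c ↔ x.1 < c.numStates ∧ (x.2.1.length ≤ B ∧ x.2.1 ⊆ edges k c) ∧
      x.2.2.length ≤ k ∧ ∀ a ∈ x.2.2, a ≤ 2 * M := by
  obtain ⟨q, w, u⟩ := x
  simp only [sideStates, List.mem_product, List.mem_range, mem_boundedLists]
  simp only [List.subset_def, List.mem_range, Nat.lt_succ_iff]

section Joint

variable (k : ℕ) (c d : AutomatonCode)

/-- A bound for the lengths of all reduced walks of both automata. -/
def lengthBound : ℕ :=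
  -- The `+ 1` makes the bound positive, so that it also covers the reading of a single letter.
  walkBound c.numStates (edges k c).length + walkBound d.numStates (edges k d).length + 1

/-- A bound for the number of pending letters. -/
def pendingBound : ℕ := (2 * k + 1) * lengthBound k c d

/-- The transition relation of the intersection automaton. -/
def JointStep (s : JointState) (a : ℕ) (s' : JointState) : Prop :=
  s'.1 = s.1 ∧
    -- During a round the next letter of the remaining list is read; when the list is used up, it is
    -- replaced by the full one.
    ((s.2.1.head? = some a ∧ (s.2.1.tail = [] ∧ s'.2.1 = s.1 ∨
        s.2.1.tail ≠ [] ∧ s'.2.1 = s.2.1.tail) ∧ s'.2.2 = s.2.2) ∨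
      -- Before the first round, a closed walk is attached while an irrelevant letter of `s.1` is
      -- consumed, or a letter outside `s.1` is read. In the latter case `Shift` is applied from the
      -- new state to the old one, since reading decreases the pending letters.
      (s.2.1 = [] ∧ s'.2.1 = [] ∧
        (a ∈ s.1 ∧ (Pumps k (lengthBound k c d) c s.1 s.2.2.1 s'.2.2.1 ∧ s'.2.2.2 = s.2.2.2 ∨
            Pumps k (lengthBound k c d) d s.1 s.2.2.2 s'.2.2.2 ∧ s'.2.2.1 = s.2.2.1) ∨
          a ∉ s.1 ∧ Shift k s.1 [a] s'.2.2.1 s.2.2.1 ∧ Shift k s.1 [a] s'.2.2.2 s.2.2.2)) ∨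
      -- The rounds begin only after both balances are back at the offset.
      (s.2.1 = [] ∧ s'.2.1 = s.1 ∧ a ∈ s.1 ∧ s'.2.2 = s.2.2 ∧
        Finishes k (lengthBound k c d) (pendingBound k c d) c s.1 s.2.2.1 ∧
        Finishes k (lengthBound k c d) (pendingBound k c d) d s.1 s.2.2.2))

/-- The initial states of the intersection automaton. -/
def JointStart (s : JointState) : Prop :=
  s.1 ≠ [] ∧ s.2.1 = [] ∧ Begins k (pendingBound k c d) c s.1 s.2.2.1 ∧
    Begins k (pendingBound k c d) d s.1 s.2.2.2

/-- The accepting states of the intersection automaton: those at the beginning of a round. -/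
def JointAccept (s : JointState) : Prop := s.2.1 = s.1

/-- The states of the intersection automaton. -/
def jointStates : List JointState :=
  boundedLists (List.range k) k ×ˢ (boundedLists (List.range k) k ×ˢ
    (sideStates k (lengthBound k c d) (pendingBound k c d) c ×ˢ
      sideStates k (lengthBound k c d) (pendingBound k c d) d))

/-- The intersection automaton. -/
noncomputable def jointCode : AutomatonCode :=
  codeOf k (jointStates k c d) (JointStep k c d) (JointStart k c d) JointAccept

end Joint

theorem mem_jointStates {k : ℕ} {c d : AutomatonCode} {s : JointState} :
    s ∈ jointStates k c d ↔ (s.1.length ≤ k ∧ s.1 ⊆ List.range k) ∧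
      (s.2.1.length ≤ k ∧ s.2.1 ⊆ List.range k) ∧
      s.2.2.1 ∈ sideStates k (lengthBound k c d) (pendingBound k c d) c ∧
      s.2.2.2 ∈ sideStates k (lengthBound k c d) (pendingBound k c d) d := by
  obtain ⟨S, R, x, y⟩ := s
  simp only [jointStates, List.mem_product, mem_boundedLists]

/-! ### Soundness of the intersection automaton. -/

/-- The word `z` together with the pending letters of `x` is read on a walk from an initial state
that contains the walk of `x`. -/
def SideInvariant (k M : ℕ) (c : AutomatonCode) (S : List ℕ) (x : SideState) (z : List ℕ) : Prop :=
  ∃ p ∈ starts c, ∃ l, l ⊆ edges k c ∧ IsWalk p l x.1 ∧ x.2.1 ⊆ l ∧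
    ∀ b < k, b ∉ S → x.2.2.getD b 0 + z.count b = M + (letters l).count b

section Side

variable {k B M : ℕ} {c : AutomatonCode} {S z : List ℕ} {x y : SideState} {a : ℕ}

theorem Begins.sideInvariant (h : Begins k M c S x) (hx : x.2.1 ⊆ edges k c) :
    SideInvariant k M c S x [] := by
  obtain ⟨⟨p, hp, hw⟩, hb⟩ := h
  exact ⟨p, hp, x.2.1, hx, hw, List.Subset.refl _, fun b hbk hbS => by
    simpa using (hb b (List.mem_range.2 hbk)).resolve_left hbS⟩

theorem letters_append (l₁ l₂ : List Edge) : letters (l₁ ++ l₂) = letters l₁ ++ letters l₂ :=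
  List.map_append

theorem count_append_singleton_of_mem {b : ℕ} (ha : a ∈ S) (hb : b ∉ S) (z : List ℕ) :
    (z ++ [a]).count b = z.count b := by
  have : a ≠ b := fun h => hb (h ▸ ha)
  simp [this]

/-- Only the short walk is stored, but it is contained in the actual walk `l`. A closed walk based
on it can therefore be inserted into `l`, and the containment persists. -/
theorem Pumps.sideInvariant (h : Pumps k B c S x y) (ha : a ∈ S)
    (hx : SideInvariant k M c S x z) : SideInvariant k M c S y (z ++ [a]) := by
  obtain ⟨r, hr, ⟨t, ht, hrw⟩, h1, h2, hb⟩ := h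
  obtain ⟨p, hp, l, hl, hw, hsub, hcount⟩ := hx
  obtain ⟨l', hw', hperm⟩ := hw.exists_insert (hsub ht) hrw
  refine ⟨p, hp, l', ?_, h1 ▸ hw', ?_, fun b hbk hbS => ?_⟩
  · intro t ht
    rcases List.mem_append.1 (hperm.mem_iff.1 ht) with h | h
    · exact (mem_boundedLists.1 hr).2 h
    · exact hl h
  · rw [h2]
    intro t ht
    exact hperm.mem_iff.2 (List.mem_append_right _ (hsub ht))
  · have e1 := (hb b (List.mem_range.2 hbk)).resolve_left hbS
    have e2 := hcount b hbk hbS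
    have e3 : (letters l').count b = (letters r).count b + (letters l).count b := by
      rw [← List.count_append, ← letters_append]
      exact (hperm.map _).count_eq b
    rw [count_append_singleton_of_mem ha hbS]
    omega

theorem Shift.sideInvariant (h : Shift k S [a] y x)
    (hx : SideInvariant k M c S x z) : SideInvariant k M c S y (z ++ [a]) := by
  obtain ⟨h1, h2, hb⟩ := h
  obtain ⟨p, hp, l, hl, hw, hsub, hcount⟩ := hx
  refine ⟨p, hp, l, hl, h1 ▸ hw, h2 ▸ hsub, fun b hbk hbS => ?_⟩
  have e1 := (hb b (List.mem_range.2 hbk)).resolve_left hbS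
  have e2 := hcount b hbk hbS
  rw [List.count_append]
  omega

theorem SideInvariant.append_of_mem (ha : a ∈ S) (hx : SideInvariant k M c S x z) :
    SideInvariant k M c S x (z ++ [a]) := by
  obtain ⟨p, hp, l, hl, hw, hsub, hcount⟩ := hx
  exact ⟨p, hp, l, hl, hw, hsub, fun b hbk hbS => by
    rw [count_append_singleton_of_mem ha hbS]; exact hcount b hbk hbS⟩

/-- With pending vector equal to the offset `M`, the two occurrences of `M` in the invariant cancel,
and the actual walk has the counts of `z` outside `S`. -/
theorem Finishes.accepts (h : Finishes k B M c S x) (hx : SideInvariant k M c S x z)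
    (hz : ∀ b ∈ z, b < k) : Accepts k c S fun b => z.count b := by
  obtain ⟨hacc, hb, r, hr, hrw, hrS, hrS'⟩ := h
  obtain ⟨p, hp, l, hl, hw, hsub, hcount⟩ := hx
  refine ⟨p, hp, x.1, hacc, l, r, hl, (mem_boundedLists.1 hr).2, hw, hrw,
    fun a => ⟨hrS' a, hrS a⟩, fun b hbS => ?_⟩
  change (letters l).count b = z.count b
  rcases Nat.lt_or_ge b k with hbk | hbk
  · have e1 := (hb b (List.mem_range.2 hbk)).resolve_left hbS
    have e2 := hcount b hbk hbS
    omega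
  · rw [List.count_eq_zero.2 fun h => absurd (lt_of_mem_letters hl h) (by omega),
      List.count_eq_zero.2 fun h => absurd (hz b h) (by omega)]

end Side

theorem AutomatonCode.Accepts.congr {k : ℕ} {c : AutomatonCode} {S S' : List ℕ} {v v' : ℕ → ℕ}
    (h : Accepts k c S v) (hS : ∀ a, a ∈ S ↔ a ∈ S') (hv : ∀ a ∉ S, v a = v' a) :
    Accepts k c S' v' := by
  obtain ⟨p, hp, q, hq, l, r, hl, hr, hlw, hrw, hrS, hlv⟩ := h
  exact ⟨p, hp, q, hq, l, r, hl, hr, hlw, hrw, fun a => (hrS a).trans (hS a), fun a ha => by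
    have : a ∉ S := fun h => ha ((hS a).1 h)
    rw [hlv a this, hv a this]⟩

section Joint

variable {k : ℕ} {c d : AutomatonCode}

/-- The meaning of the states of the intersection automaton that are reached by reading `z`. -/
def JointInvariant (k : ℕ) (c d : AutomatonCode) (s : JointState) (z : List ℕ) : Prop :=
  s.1 ≠ [] ∧ (∀ b ∈ z, b < k) ∧
    ((s.2.1 = [] ∧ SideInvariant k (pendingBound k c d) c s.1 s.2.2.1 z ∧
        SideInvariant k (pendingBound k c d) d s.1 s.2.2.2 z) ∨
      (s.2.1 ≠ [] ∧ s.2.1 ⊆ s.1 ∧ Accepts k c s.1 (fun b => z.count b) ∧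
        Accepts k d s.1 fun b => z.count b))

theorem JointStep.of_cons {s s' : JointState} {a b : ℕ} {R : List ℕ} (h : JointStep k c d s a s')
    (hR : s.2.1 = b :: R) :
    a = b ∧ s'.1 = s.1 ∧ s'.2.1 = if R = [] then s.1 else R := by
  obtain ⟨h1, h | h | h⟩ := h
  · obtain ⟨h2, h3, -⟩ := h
    rw [hR] at h2 h3
    simp only [List.head?_cons, Option.some.injEq, List.tail_cons] at h2 h3
    refine ⟨h2.symm, h1, ?_⟩
    split_ifs with h0
    · simpa [h0] using h3
    · simpa [h0] using h3
  · rw [hR] at h; simp at h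
  · rw [hR] at h; simp at h

/-- Before the rounds the side invariants are carried along, and `Finishes` converts them into
acceptance. Inside a round only letters of `s.1` are read, which leaves the relevant counts
unchanged. -/
theorem JointInvariant.step {s s' : JointState} {a : ℕ} {z : List ℕ}
    (hs : JointInvariant k c d s z) (h : JointStep k c d s a s') (ha : a < k) :
    JointInvariant k c d s' (z ++ [a]) := by
  obtain ⟨h0, hz, hs⟩ := hs
  have hz' : ∀ b ∈ z ++ [a], b < k := by
    intro b hb
    rcases List.mem_append.1 hb with hb | hb
    · exact hz b hb
    · rw [List.mem_singleton.1 hb]; exact ha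
  rcases hs with ⟨hR, hx, hy⟩ | ⟨hR, hsub, hx, hy⟩
  · obtain ⟨h1, h | ⟨-, hR', h⟩ | ⟨-, hR', haS, h2, hx', hy'⟩⟩ := h
    · rw [hR] at h; simp at h
    · refine ⟨h1 ▸ h0, hz', Or.inl ⟨hR', ?_⟩⟩
      rw [h1]
      rcases h with ⟨haS, ⟨h, he⟩ | ⟨h, he⟩⟩ | ⟨-, h, h'⟩
      · exact ⟨h.sideInvariant haS hx, he ▸ hy.append_of_mem haS⟩
      · exact ⟨he ▸ hx.append_of_mem haS, h.sideInvariant haS hy⟩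
      · exact ⟨h.sideInvariant hx, h'.sideInvariant hy⟩
    · refine ⟨h1 ▸ h0, hz', Or.inr ⟨hR' ▸ h0, ?_, ?_⟩⟩
      · rw [hR', h1]
        exact List.Subset.refl _
      rw [h1]
      exact ⟨hx'.accepts (hx.append_of_mem haS) hz', hy'.accepts (hy.append_of_mem haS) hz'⟩
  · obtain ⟨b, R, hbR⟩ := List.exists_cons_of_ne_nil hR
    obtain ⟨rfl, h1, h2⟩ := h.of_cons hbR
    rw [hbR, List.cons_subset] at hsub
    refine ⟨h1 ▸ h0, hz', Or.inr ⟨?_, ?_, ?_⟩⟩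
    · rw [h2]; split_ifs with h
      · exact h0
      · exact h
    · rw [h2, h1]; split_ifs
      · exact List.Subset.refl _
      · exact hsub.2
    · have hc : ∀ b ∉ s.1, z.count b = (z ++ [a]).count b := fun b hb =>
        (count_append_singleton_of_mem hsub.1 hb z).symm
      rw [h1]
      exact ⟨hx.congr (fun _ => Iff.rfl) hc, hy.congr (fun _ => Iff.rfl) hc⟩

theorem JointInvariant.reads {L : List JointState} {s s' : JointState} {x z : List ℕ}
    (hs : JointInvariant k c d s z) (h : Reads L (JointStep k c d) s x s') (hx : ∀ a ∈ x, a < k) :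
    JointInvariant k c d s' (z ++ x) := by
  induction x generalizing s z with
  | nil => cases h; simpa using hs
  | cons a x ih =>
    obtain ⟨m, -, hstep, h⟩ := h
    have := ih (hs.step hstep (hx a List.mem_cons_self)) h
      fun b hb => hx b (List.mem_cons_of_mem _ hb)
    simpa using this

theorem subset_of_reads {L : List JointState} {s s' : JointState} {r : List ℕ} (h0 : s.1 ≠ [])
    (hR : s.2.1 ≠ []) (hsub : s.2.1 ⊆ s.1) (h : Reads L (JointStep k c d) s r s') : r ⊆ s.1 := by
  induction r generalizing s with
  | nil => simp
  | cons a r ih =>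
    obtain ⟨m, -, hstep, h⟩ := h
    obtain ⟨b, R, hbR⟩ := List.exists_cons_of_ne_nil hR
    obtain ⟨rfl, h1, h2⟩ := hstep.of_cons hbR
    rw [hbR, List.cons_subset] at hsub
    rw [List.cons_subset]
    refine ⟨hsub.1, ?_⟩
    rw [← h1]
    refine ih (h1 ▸ h0) ?_ ?_ h
    · rw [h2]; split_ifs with h
      · exact h0
      · exact h
    · rw [h2, h1]; split_ifs
      · exact List.Subset.refl _
      · exact hsub.2

/-- The remaining list gets strictly shorter than `s.1` and equals it again only after being
exhausted. Hence a nonempty path to an accepting state reads all that was left of the round. -/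
theorem subset_letters_of_reads {L : List JointState} {s s' : JointState} {r : List ℕ}
    (hlen : s.2.1.length ≤ s.1.length) (hacc : JointAccept s') (hr : r ≠ [])
    (h : Reads L (JointStep k c d) s r s') : s.2.1 ⊆ r := by
  induction r generalizing s with
  | nil => exact absurd rfl hr
  | cons a r ih =>
    obtain ⟨m, -, hstep, h⟩ := h
    rcases hR : s.2.1 with _ | ⟨b, R⟩
    · simp
    · obtain ⟨rfl, h1, h2⟩ := hstep.of_cons hR
      rw [hR, List.length_cons] at hlen
      by_cases hR0 : R = []
      · subst hR0; simp
      · rw [if_neg hR0] at h2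
        rw [List.cons_subset]
        refine ⟨List.mem_cons_self, ?_⟩
        by_cases hr0 : r = []
        · subst hr0
          cases h
          have := congrArg List.length hacc
          rw [h2, h1] at this
          omega
        · have := ih (by rw [h2, h1]; omega) hr0 h
          rw [h2] at this
          exact fun t ht => List.mem_cons_of_mem _ (this ht)

theorem accepts_of_accepts_jointCode {S : List ℕ} {v : ℕ → ℕ} (hS : S ≠ [])
    (h : Accepts k (jointCode k c d) S v) : Accepts k c S v ∧ Accepts k d S v := by
  obtain ⟨s, hs, ⟨h0, hR, hc, hd⟩, s', -, hacc, x, r, hx, hr, hxR, hrR, hrS, hv⟩ :=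
    accepts_codeOf.1 h
  obtain ⟨-, -, hs₁, hs₂⟩ := mem_jointStates.1 hs
  have hinv : JointInvariant k c d s [] := ⟨h0, by simp, Or.inl ⟨hR,
    hc.sideInvariant (mem_sideStates.1 hs₁).2.1.2, hd.sideInvariant (mem_sideStates.1 hs₂).2.1.2⟩⟩
  obtain ⟨h0', -, hinv'⟩ := hinv.reads hxR hx
  have hacc' : s'.2.1 = s'.1 := hacc
  -- An accepting state has remaining list `s'.1`, which is nonempty, so the rounds have begun.
  rcases hinv' with ⟨h1, -⟩ | ⟨hne, hsub, hc', hd'⟩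
  · rw [hacc'] at h1
    exact absurd h1 h0'
  · have hr0 : r ≠ [] := by
      obtain ⟨a, t, rfl⟩ := List.exists_cons_of_ne_nil hS
      exact List.ne_nil_of_mem ((hrS a).2 List.mem_cons_self)
    have h1 := subset_of_reads h0' hne hsub hrR
    have h2 := subset_letters_of_reads (by rw [hacc']) hacc hr0 hrR
    rw [hacc'] at h2
    have hSS : ∀ a, a ∈ s'.1 ↔ a ∈ S := fun a =>
      ⟨fun h => (hrS a).1 (h2 h), fun h => h1 ((hrS a).2 h)⟩
    have hvv : ∀ a ∉ s'.1, ([] ++ x).count a = v a := fun a ha =>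
      hv a fun h => ha ((hSS a).2 h)
    exact ⟨hc'.congr hSS hvv, hd'.congr hSS hvv⟩

end Joint

/-! ### Completeness: scheduling the moves with bounded balances. -/

/-- The walk to the accepting state keeps its closed walks, since its counts matter. The final loop
may lose them: the short walk has the same edges and hence the same set of letters. -/
theorem AutomatonCode.Accepts.exists_reduction {k B : ℕ} {c : AutomatonCode} {S : List ℕ}
    {v : ℕ → ℕ} (h : Accepts k c S v) (hB : walkBound c.numStates (edges k c).length ≤ B) :
    ∃ p ∈ starts c, ∃ q ∈ c.accepting, q < c.numStates ∧ ∃ w ∈ boundedLists (edges k c) B,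
      ∃ (cs : List (List Edge)), ∃ r ∈ boundedLists (edges k c) B, IsWalk p w q ∧
      (∀ l ∈ cs, l ∈ boundedLists (edges k c) B ∧ ∃ t ∈ w, IsWalk t.1 l t.1) ∧
      IsWalk q r q ∧ (∀ a, a ∈ letters r ↔ a ∈ S) ∧
      ∀ a ∉ S, (letters w).count a + (cs.map fun l => (letters l).count a).sum = v a := by
  obtain ⟨p, hp, q, hq, l, r, hl, hr, hlw, hrw, hrS, hlv⟩ := h
  have hn : ∀ t ∈ edges k c, t.1 < c.numStates := fun t ht => (mem_edges.1 ht).2.1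
  obtain ⟨w, cs, hw, hperm, hwlen, -, hwsub, hcs⟩ := hlw.exists_reduction hn hl
  obtain ⟨r', -, hr', -, hrlen, hrsub, hrsub', -⟩ := hrw.exists_reduction hn hr
  refine ⟨p, hp, q, hq, hlw.lt_of_subset_edges hl (mem_starts.1 hp).2, w,
    mem_boundedLists.2 ⟨hwlen.trans hB, List.Subset.trans hwsub hl⟩, cs, r',
    mem_boundedLists.2 ⟨hrlen.trans hB, List.Subset.trans hrsub' hr⟩, hw, fun x hx => ?_, hr',
    fun a => ?_, fun a ha => ?_⟩
  · obtain ⟨h1, h2, h3⟩ := hcs x hx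
    exact ⟨mem_boundedLists.2 ⟨h1.trans hB, h2⟩, h3⟩
  · rw [← hrS]
    simp only [letters, List.mem_map]
    exact ⟨fun ⟨t, ht, h⟩ => ⟨t, hrsub' ht, h⟩, fun ⟨t, ht, h⟩ => ⟨t, hrsub ht, h⟩⟩
  · rw [← hlv a ha, show (letters l).count a = (letters (w ++ cs.flatten)).count a from
      (hperm.map _).count_eq a, letters_append, List.count_append]
    congr 1
    rw [letters, List.map_flatten, List.count_flatten, List.map_map]
    rfl

/-- The contributions to the vectors of pending letters: the initial pair of walks, closed walks on
the left and on the right, and the letters that are read. -/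
inductive Move
  | base
  | left (l : List Edge)
  | right (l : List Edge)
  | read (a : ℕ)

namespace Move

/-- The change of the pending letters `b`, on the left (`false`) or on the right (`true`). -/
def change (w₁ w₂ : List Edge) : Move → ℕ → Bool → ℤ
  | base, b, false => (letters w₁).count b
  | base, b, true => (letters w₂).count b
  | left l, b, false => (letters l).count b
  | left _, _, true => 0
  | right _, _, false => 0
  | right l, b, true => (letters l).count b
  | read a, b, _ => -([a].count b : ℕ)

/-- The change of the pending letters outside `S`. -/
def vec (S : List ℕ) (w₁ w₂ : List Edge) (m : Move) (b : ℕ) (i : Bool) : ℤ :=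
  if b ∈ S then 0 else m.change w₁ w₂ b i

/-- The moves that the intersection automaton can perform. -/
def Valid (k B : ℕ) (c d : AutomatonCode) (S : List ℕ) (w₁ w₂ : List Edge) : Move → Prop
  | base => False
  | left l => l ∈ boundedLists (edges k c) B ∧ ∃ t ∈ w₁, IsWalk t.1 l t.1
  | right l => l ∈ boundedLists (edges k d) B ∧ ∃ t ∈ w₂, IsWalk t.1 l t.1
  | read a => a ∉ S ∧ a < k

/-- The letter read during a move, where `s` is read if there is nothing else to read. -/
def letter (s : ℕ) : Move → ℕ
  | read a => a
  | _ => s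

end Move

/-- The state before the first round with pending letters given by `f`. -/
def home (k : ℕ) (S : List ℕ) (q₁ q₂ : ℕ) (w₁ w₂ : List Edge) (f : ℕ → Bool → ℤ) : JointState :=
  (S, [], (q₁, w₁, (List.range k).map fun b => (f b false).toNat),
    (q₂, w₂, (List.range k).map fun b => (f b true).toNat))

theorem getD_map_range {k b : ℕ} (hb : b < k) (f : ℕ → ℕ) :
    ((List.range k).map f).getD b 0 = f b := by
  rw [List.getD_eq_getElem _ _ (by simpa using hb)]
  simp

section Home

variable {k : ℕ} {c d : AutomatonCode} {S : List ℕ} {q₁ q₂ : ℕ} {w₁ w₂ : List Edge}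

/-- Balances are integers here because they arise as partial sums; nonnegativity makes the
truncation in `home` exact. -/
theorem jointStep_home {s : ℕ} (hs : s ∈ S) {m : Move}
    (hm : m.Valid k (lengthBound k c d) c d S w₁ w₂) {f g : ℕ → Bool → ℤ}
    (hf : ∀ b < k, ∀ i, 0 ≤ f b i) (hg : ∀ b < k, ∀ i, 0 ≤ g b i)
    (hfg : ∀ b i, g b i = f b i + m.vec S w₁ w₂ b i) :
    JointStep k c d (home k S q₁ q₂ w₁ w₂ f) (m.letter s) (home k S q₁ q₂ w₁ w₂ g) := by
  refine ⟨rfl, Or.inr (Or.inl ⟨rfl, rfl, ?_⟩)⟩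
  cases m with
  | base => exact hm.elim
  | left l =>
    refine Or.inl ⟨hs, Or.inl ⟨⟨l, hm.1, hm.2, rfl, rfl, fun b hb => ?_⟩, ?_⟩⟩
    · rw [List.mem_range] at hb
      by_cases hbS : b ∈ S
      · exact Or.inl hbS
      · right
        have h1 := hf b hb false
        have h2 := hg b hb false
        have h3 := hfg b false
        simp only [Move.vec, hbS, if_false, Move.change] at h3
        simp only [home, getD_map_range hb]
        omega
    · simp [home, hfg, Move.vec, Move.change]
  | right l =>
    refine Or.inl ⟨hs, Or.inr ⟨⟨l, hm.1, hm.2, rfl, rfl, fun b hb => ?_⟩, ?_⟩⟩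
    · rw [List.mem_range] at hb
      by_cases hbS : b ∈ S
      · exact Or.inl hbS
      · right
        have h1 := hf b hb true
        have h2 := hg b hb true
        have h3 := hfg b true
        simp only [Move.vec, hbS, if_false, Move.change] at h3
        simp only [home, getD_map_range hb]
        omega
    · simp [home, hfg, Move.vec, Move.change]
  | read a =>
    have key : ∀ b < k, b ∉ S → ∀ i, (f b i).toNat = (g b i).toNat + [a].count b := by
      intro b hb hbS i
      have h1 := hf b hb i
      have h2 := hg b hb i
      have h3 := hfg b i
      simp only [Move.vec, hbS, if_false, Move.change] at h3
      omega
    refine Or.inr ⟨hm.1, ⟨rfl, rfl, fun b hb => ?_⟩, ⟨rfl, rfl, fun b hb => ?_⟩⟩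
    all_goals
      rw [List.mem_range] at hb
      by_cases hbS : b ∈ S
      · exact Or.inl hbS
      · right
        simp only [home, getD_map_range hb, Move.letter]
        exact key b hb hbS _

theorem reads_home {L : List JointState} {s : ℕ} (hs : s ∈ S) {N : ℤ}
    (hL : ∀ f : ℕ → Bool → ℤ, (∀ b < k, ∀ i, 0 ≤ f b i ∧ f b i ≤ N) →
      home k S q₁ q₂ w₁ w₂ f ∈ L)
    (ms : List Move) (hms : ∀ m ∈ ms, m.Valid k (lengthBound k c d) c d S w₁ w₂)
    (f : ℕ → Bool → ℤ) (hf : ∀ p, p <+: ms → ∀ b < k, ∀ i,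
      0 ≤ f b i + (p.map fun m => m.vec S w₁ w₂ b i).sum ∧
        f b i + (p.map fun m => m.vec S w₁ w₂ b i).sum ≤ N) :
    Reads L (JointStep k c d) (home k S q₁ q₂ w₁ w₂ f) (ms.map (Move.letter s))
      (home k S q₁ q₂ w₁ w₂ fun b i => f b i + (ms.map fun m => m.vec S w₁ w₂ b i).sum) := by
  induction ms generalizing f with
  | nil => simp [Reads]
  | cons m ms ih =>
    have h0 := hf [] List.nil_prefix
    have h1 := hf [m] (by simp)
    simp only [List.map_nil, List.sum_nil, add_zero, List.map_cons, List.sum_cons] at h0 h1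
    refine ⟨home k S q₁ q₂ w₁ w₂ fun b i => f b i + m.vec S w₁ w₂ b i, hL _ h1,
      jointStep_home hs (hms m List.mem_cons_self) (fun b hb i => (h0 b hb i).1)
        (fun b hb i => (h1 b hb i).1) (fun _ _ => rfl), ?_⟩
    have := ih (fun m' hm' => hms m' (List.mem_cons_of_mem _ hm'))
      (fun b i => f b i + m.vec S w₁ w₂ b i) (fun p hp b hb i => by
        have := hf (m :: p) (List.cons_prefix_cons.2 ⟨rfl, hp⟩) b hb i
        simpa [add_assoc] using this)
    simpa [add_assoc] using this

theorem home_mem_jointStates (hS : S.length ≤ k ∧ S ⊆ List.range k)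
    (hq₁ : q₁ < c.numStates) (hq₂ : q₂ < d.numStates)
    (hw₁ : w₁ ∈ boundedLists (edges k c) (lengthBound k c d))
    (hw₂ : w₂ ∈ boundedLists (edges k d) (lengthBound k c d)) (f : ℕ → Bool → ℤ)
    (hf : ∀ b < k, ∀ i, 0 ≤ f b i ∧ f b i ≤ 2 * (pendingBound k c d : ℕ)) :
    home k S q₁ q₂ w₁ w₂ f ∈ jointStates k c d := by
  have key : ∀ i, ∀ a ∈ (List.range k).map (fun b => (f b i).toNat),
      a ≤ 2 * pendingBound k c d := by
    intro i a ha
    obtain ⟨b, hb, rfl⟩ := List.mem_map.1 ha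
    have := hf b (List.mem_range.1 hb) i
    omega
  refine mem_jointStates.2 ⟨hS, by simp [home], mem_sideStates.2 ⟨hq₁, mem_boundedLists.1 hw₁, ?_⟩,
    mem_sideStates.2 ⟨hq₂, mem_boundedLists.1 hw₂, ?_⟩⟩
  · exact ⟨by simp [home], key false⟩
  · exact ⟨by simp [home], key true⟩

theorem reads_round {x y : SideState} {R : List ℕ} (hR : R ≠ [])
    (hL : ∀ T, T <:+ R ∨ T = S → (S, T, x, y) ∈ jointStates k c d) :
    Reads (jointStates k c d) (JointStep k c d) (S, R, x, y) R (S, S, x, y) := by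
  induction R with
  | nil => exact absurd rfl hR
  | cons a R ih =>
    by_cases h : R = []
    · subst h
      exact ⟨_, hL S (Or.inr rfl), ⟨rfl, Or.inl ⟨rfl, Or.inl ⟨rfl, rfl⟩, rfl⟩⟩, rfl⟩
    · exact ⟨(S, R, x, y), hL R (Or.inl (List.suffix_cons a R)),
        ⟨rfl, Or.inl ⟨rfl, Or.inr ⟨h, rfl⟩, rfl⟩⟩,
        ih h fun T hT => hL T (hT.imp_left fun h => h.trans (List.suffix_cons a R))⟩

end Home

/-- The moves can be ordered so that all vectors of pending letters remain bounded. -/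
theorem exists_perm_bounded (k B : ℕ) (hB : 1 ≤ B) (S : List ℕ) (w₁ w₂ : List Edge)
    (ms : List Move) (hms : ∀ m ∈ Move.base :: ms, ∀ b i, |m.vec S w₁ w₂ b i| ≤ B)
    (hsum : ∀ b < k, ∀ i, ((Move.base :: ms).map fun m => m.vec S w₁ w₂ b i).sum = 0) :
    ∃ ms', ms'.Perm ms ∧ ∀ p, p <+: ms' → ∀ b < k, ∀ i,
      |((Move.base :: p).map fun m => m.vec S w₁ w₂ b i).sum| ≤ ((2 * k + 1) * B : ℕ) := by
  obtain ⟨l, hperm, hl⟩ := exists_perm_prefix_sum_bounded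
    (fun (m : Move) (j : Fin k × Bool) => (m.vec S w₁ w₂ j.1 j.2 : ℝ)) B (by positivity)
    (Move.base :: ms) (fun m hm j => by exact_mod_cast hms m hm j.1 j.2) (fun j => by
      have := congrArg (Int.cast : ℤ → ℝ) (hsum j.1 j.1.2 j.2)
      rw [Int.cast_list_sum, List.map_map] at this
      simpa [Function.comp_def] using this)
  have hl' : ∀ p, p <+: l → ∀ b < k, ∀ i,
      |(p.map fun m => m.vec S w₁ w₂ b i).sum| ≤ (2 * k * B : ℕ) := by
    intro p hp b hb i
    have := hl p hp (⟨b, hb⟩, i)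
    have hcast : ((p.map fun m => (m.vec S w₁ w₂ b i : ℝ)).sum)
        = (((p.map fun m => m.vec S w₁ w₂ b i).sum : ℤ) : ℝ) := by
      rw [Int.cast_list_sum, List.map_map]; rfl
    simp only [Fintype.card_prod, Fintype.card_fin, Fintype.card_bool] at this
    rw [hcast] at this
    have h2 : ((k * 2 : ℕ) : ℝ) * (B : ℝ) = ((2 * k * B : ℕ) : ℤ) := by push_cast; ring
    rw [h2] at this
    exact_mod_cast this
  -- The Steinitz order may place `base` anywhere, but the automaton starts with it. Moving it to
  -- the front changes each partial sum by at most `B`, whence `2 * k + 1` in place of the dimension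
  -- `2 * k`.
  obtain ⟨x, y, rfl⟩ := List.append_of_mem (hperm.mem_iff.2 List.mem_cons_self)
  refine ⟨x ++ y, (List.perm_cons _).1 (List.perm_middle.symm.trans hperm), fun p hp b hb i => ?_⟩
  have hMB : ((2 * k + 1) * B : ℕ) = 2 * k * B + B := by ring
  rw [hMB]
  obtain ⟨t, ht⟩ := hp
  rcases List.append_eq_append_iff.1 ht with ⟨u, rfl, -⟩ | ⟨u, rfl, rfl⟩
  · have h1 := hl' p ((List.prefix_append p u).trans (List.prefix_append _ _)) b hb i
    have h2 := hms Move.base List.mem_cons_self b i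
    rw [List.map_cons, List.sum_cons]
    have := abs_add_le (Move.base.vec S w₁ w₂ b i) (p.map fun m => m.vec S w₁ w₂ b i).sum
    push_cast at h1 ⊢
    linarith
  · have h1 := hl' (x ++ Move.base :: u) ⟨t, by simp⟩ b hb i
    have h2 : ((x ++ Move.base :: u).map fun m => m.vec S w₁ w₂ b i).sum
        = ((Move.base :: (x ++ u)).map fun m => m.vec S w₁ w₂ b i).sum :=
      (List.perm_middle.map _).sum_eq
    rw [h2] at h1
    push_cast at h1 ⊢
    have : (0 : ℤ) ≤ B := by positivity
    linarith

theorem sum_map_neg_count_singleton (X : List ℕ) (b : ℕ) :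
    (X.map fun a => -(([a].count b : ℕ) : ℤ)).sum = -(X.count b : ℕ) := by
  induction X with
  | nil => simp
  | cons a X ih =>
    rw [List.map_cons, List.sum_cons, ih, show a :: X = [a] ++ X from rfl, List.count_append]
    push_cast
    ring

theorem count_letters_le {B : ℕ} {E l : List Edge} (hl : l ∈ boundedLists E B) (b : ℕ) :
    (letters l).count b ≤ B := by
  refine List.count_le_length.trans ?_
  simpa [letters] using (mem_boundedLists.1 hl).1

/-- The accepted word consists of the letters of the moves in Steinitz order, one further letter of
`S` to enter the rounds, and then `S` itself as the loop. -/
theorem accepts_jointCode {k : ℕ} {c d : AutomatonCode} {S : List ℕ} {v : ℕ → ℕ} (hS0 : S ≠ [])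
    (hS : S.length ≤ k ∧ S ⊆ List.range k) (hc : Accepts k c S v) (hd : Accepts k d S v) :
    Accepts k (jointCode k c d) S v := by
  set B := lengthBound k c d with hBdef
  set M := pendingBound k c d with hMdef
  have hMB : M = (2 * k + 1) * B := rfl
  obtain ⟨s, hs⟩ := List.exists_mem_of_ne_nil S hS0
  obtain ⟨X, hXS, hXv⟩ : ∃ X : List ℕ, (∀ a ∈ X, a ∉ S ∧ a < k) ∧ ∀ b ∉ S, X.count b = v b := by
    obtain ⟨-, -, -, -, l, -, hl, -, -, -, -, hlv⟩ := hc
    refine ⟨(letters l).filter (· ∉ S), fun a ha => ?_, fun b hb => ?_⟩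
    · rw [List.mem_filter] at ha
      exact ⟨by simpa using ha.2, lt_of_mem_letters hl ha.1⟩
    · rw [List.count_filter (by simpa using hb), hlv b hb]
  obtain ⟨p₁, hp₁, q₁, hq₁, hqn₁, w₁, hw₁, cs₁, r₁, hr₁, hpw₁, hcs₁, hrw₁, hrS₁, hv₁⟩ :=
    hc.exists_reduction (B := B) (by rw [hBdef, lengthBound]; omega)
  obtain ⟨p₂, hp₂, q₂, hq₂, hqn₂, w₂, hw₂, cs₂, r₂, hr₂, hpw₂, hcs₂, hrw₂, hrS₂, hv₂⟩ :=
    hd.exists_reduction (B := B) (by rw [hBdef, lengthBound]; omega)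
  have hB1 : 1 ≤ B := by rw [hBdef, lengthBound]; omega
  let ms : List Move := cs₁.map Move.left ++ (cs₂.map Move.right ++ X.map Move.read)
  have hvalid : ∀ m ∈ ms, m.Valid k B c d S w₁ w₂ := by
    intro m hm
    simp only [ms, List.mem_append, List.mem_map] at hm
    rcases hm with ⟨l, hl, rfl⟩ | ⟨l, hl, rfl⟩ | ⟨a, ha, rfl⟩
    · exact hcs₁ l hl
    · exact hcs₂ l hl
    · exact hXS a ha
  have hbound : ∀ m ∈ Move.base :: ms, ∀ b i, |m.vec S w₁ w₂ b i| ≤ B := by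
    intro m hm b i
    have hcount : ∀ (E l : List Edge), l ∈ boundedLists E B →
        |(((letters l).count b : ℕ) : ℤ)| ≤ B := fun E l hl => by
      rw [abs_of_nonneg (by positivity)]
      exact_mod_cast count_letters_le hl b
    have h0 : |(0 : ℤ)| ≤ B := by simp
    unfold Move.vec
    split_ifs
    · exact h0
    · rcases List.mem_cons.1 hm with rfl | hm
      · cases i
        · exact hcount _ _ hw₁
        · exact hcount _ _ hw₂
      · have hval := hvalid m hm
        cases m with
        | base => exact hval.elim
        | left l =>
          cases i
          · exact hcount _ _ hval.1
          · exact h0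
        | right l =>
          cases i
          · exact h0
          · exact hcount _ _ hval.1
        | read a =>
          have h1 : ([a].count b : ℕ) ≤ 1 := List.count_le_length
          simp only [Move.change, abs_neg]
          rw [abs_of_nonneg (by positivity)]
          exact_mod_cast h1.trans hB1
  -- On either side the short walk and its closed walks contribute `v b`, and the letters of `X`
  -- take it away again.
  have hsum : ∀ b < k, ∀ i, ((Move.base :: ms).map fun m => m.vec S w₁ w₂ b i).sum = 0 := by
    intro b _ i
    by_cases hb : b ∈ S
    · simp [Move.vec, hb]
    · have e1 := hv₁ b hb
      have e2 := hv₂ b hb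
      have e3 := hXv b hb
      have e4 := sum_map_neg_count_singleton X b
      zify at e1 e2 e3
      cases i
      · simp only [Move.vec, hb, if_false, ms, List.map_cons, List.map_append, List.map_map,
          List.sum_cons, List.sum_append, Function.comp_def, Move.change, e4]
        rw [List.map_map] at e1
        simp only [Function.comp_def] at e1
        simp only [List.map_const', List.sum_replicate, smul_zero]
        linarith
      · simp only [Move.vec, hb, if_false, ms, List.map_cons, List.map_append, List.map_map,
          List.sum_cons, List.sum_append, Function.comp_def, Move.change, e4]
        rw [List.map_map] at e2
        simp only [Function.comp_def] at e2
        simp only [List.map_const', List.sum_replicate, smul_zero]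
        linarith
  obtain ⟨ms', hperm, hms'⟩ := exists_perm_bounded k B hB1 S w₁ w₂ ms hbound hsum
  rw [← hMB] at hms'
  -- The offset `M` turns partial sums in `[-M, M]` into entries in `[0, 2 * M]`.
  let f : ℕ → Bool → ℤ := fun b i => M + Move.base.vec S w₁ w₂ b i
  have hf : ∀ p, p <+: ms' → ∀ b < k, ∀ i,
      0 ≤ f b i + (p.map fun m => m.vec S w₁ w₂ b i).sum ∧
        f b i + (p.map fun m => m.vec S w₁ w₂ b i).sum ≤ 2 * (M : ℕ) := by
    intro p hp b hb i
    have := abs_le.1 (hms' p hp b hb i)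
    simp only [List.map_cons, List.sum_cons] at this
    simp only [f]
    constructor <;> linarith [this.1, this.2]
  have hmem := home_mem_jointStates (c := c) (d := d) hS hqn₁ hqn₂ hw₁ hw₂
  have hreads := reads_home (c := c) (d := d) hs hmem ms'
    (fun m hm => hvalid m (hperm.mem_iff.1 hm)) f hf
  set g : ℕ → Bool → ℤ := fun b i => f b i + (ms'.map fun m => m.vec S w₁ w₂ b i).sum
  have hg : ∀ b < k, ∀ i, g b i = M := by
    intro b hb i
    have h1 := hsum b hb i
    rw [List.map_cons, List.sum_cons, ← (hperm.map fun m => m.vec S w₁ w₂ b i).sum_eq] at h1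
    simp only [g, f]
    linarith
  have hgmem := hmem g fun b hb i => by rw [hg b hb i]; constructor <;> linarith
  have hround : ∀ T, T <:+ S ∨ T = S →
      (S, T, (home k S q₁ q₂ w₁ w₂ g).2.2) ∈ jointStates k c d := by
    intro T hT
    obtain ⟨h1, -, h2, h3⟩ := mem_jointStates.1 hgmem
    have hTS : T <:+ S := hT.elim id fun h => h ▸ List.suffix_rfl
    exact mem_jointStates.2 ⟨h1, ⟨hTS.length_le.trans hS.1, List.Subset.trans hTS.subset hS.2⟩,
      h2, h3⟩
  have hf0 : ∀ b < k, ∀ i, 0 ≤ f b i ∧ f b i ≤ 2 * (M : ℕ) := fun b hb i => by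
    simpa using hf [] List.nil_prefix b hb i
  have hkS : ∀ a ∈ S, a < k := fun a ha => List.mem_range.1 (hS.2 ha)
  have hfin : JointStep k c d (home k S q₁ q₂ w₁ w₂ g) s
      (S, S, (home k S q₁ q₂ w₁ w₂ g).2.2) := by
    refine ⟨rfl, Or.inr (Or.inr ⟨rfl, rfl, hs, rfl, ⟨hq₁, fun b hb => Or.inr ?_, r₁, hr₁, hrw₁,
      fun a => (hrS₁ a).2, fun a => (hrS₁ a).1⟩, ⟨hq₂, fun b hb => Or.inr ?_, r₂, hr₂, hrw₂,
      fun a => (hrS₂ a).2, fun a => (hrS₂ a).1⟩⟩)⟩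
    all_goals
      rw [List.mem_range] at hb
      simp only [home, getD_map_range hb, hg b hb]
      rfl
  refine accepts_codeOf.2 ⟨home k S q₁ q₂ w₁ w₂ f, hmem f hf0, ⟨hS0, rfl,
    ⟨⟨p₁, hp₁, hpw₁⟩, fun b hb => ?_⟩, ⟨⟨p₂, hp₂, hpw₂⟩, fun b hb => ?_⟩⟩,
    (S, S, (home k S q₁ q₂ w₁ w₂ g).2.2), hround S (Or.inr rfl), rfl,
    ms'.map (Move.letter s) ++ [s], S, ?_, hkS,
    hreads.append ⟨_, hround S (Or.inr rfl), hfin, rfl⟩, reads_round hS0 hround,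
    fun _ => Iff.rfl, fun b hb => ?_⟩
  · rw [List.mem_range] at hb
    by_cases hbS : b ∈ S
    · exact Or.inl hbS
    · right
      simp only [home, getD_map_range hb, f, Move.vec, hbS, if_false, Move.change]
      omega
  · rw [List.mem_range] at hb
    by_cases hbS : b ∈ S
    · exact Or.inl hbS
    · right
      simp only [home, getD_map_range hb, f, Move.vec, hbS, if_false, Move.change]
      omega
  · intro a ha
    rcases List.mem_append.1 ha with ha | ha
    · obtain ⟨m, hm, rfl⟩ := List.mem_map.1 ha
      have hval := hvalid m (hperm.mem_iff.1 hm)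
      cases m with
      | read a => exact hval.2
      | _ => exact hkS s hs
    · rw [List.mem_singleton.1 ha]
      exact hkS s hs
  · rw [count_append_singleton_of_mem hs hb, (hperm.map (Move.letter s)).count_eq, ← hXv b hb]
    have hsb : s ≠ b := fun h => hb (h ▸ hs)
    simp [ms, Function.comp_def, Move.letter, List.count_replicate, hsb]

/-! ### Primitive recursiveness of the construction. -/

section Primrec

variable {β τ υ : Type*} [Primcodable β] [Primcodable τ] [Primcodable υ]

/-- The quantifiers in the predicates defining the intersection automaton range over explicit lists,
so this lemma and its dual handle all of them. -/
theorem primrecPred_exists_mem {l : β → List τ} {p : β → τ → Prop} (hl : Primrec l)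
    (hp : PrimrecPred fun y : β × τ => p y.1 y.2) : PrimrecPred fun b => ∃ x ∈ l b, p b x := by
  have h : PrimrecRel fun (t : τ) (b : β) => p b t :=
    hp.comp (Primrec.pair Primrec.snd Primrec.fst)
  exact h.exists_mem_list.comp hl Primrec.id

theorem primrecPred_forall_mem {l : β → List τ} {p : β → τ → Prop} (hl : Primrec l)
    (hp : PrimrecPred fun y : β × τ => p y.1 y.2) : PrimrecPred fun b => ∀ x ∈ l b, p b x := by
  have h : PrimrecRel fun (t : τ) (b : β) => p b t :=
    hp.comp (Primrec.pair Primrec.snd Primrec.fst)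
  exact h.forall_mem_list.comp hl Primrec.id

theorem primrec_filter {l : β → List τ} {p : β → τ → Prop} [∀ b, DecidablePred (p b)]
    (hl : Primrec l) (hp : PrimrecPred fun y : β × τ => p y.1 y.2) :
    Primrec fun b => (l b).filter fun x => p b x := by
  have h : PrimrecRel fun (t : τ) (b : β) => p b t :=
    hp.comp (Primrec.pair Primrec.snd Primrec.fst)
  let _ : DecidableRel fun (t : τ) (b : β) => p b t := fun t b => inferInstanceAs (Decidable (p b t))
  refine (h.listFilter.comp hl Primrec.id).of_eq fun b => rfl

theorem primrecPred_mem {l : β → List τ} {f : β → τ} (hl : Primrec l) (hf : Primrec f) :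
    PrimrecPred fun b => f b ∈ l b :=
  (primrecPred_exists_mem (p := fun b x => x = f b) hl
    (Primrec.eq.comp Primrec.snd (hf.comp Primrec.fst))).of_eq fun b => by simp

theorem primrec_count {l : β → List ℕ} {f : β → ℕ} (hl : Primrec l) (hf : Primrec f) :
    Primrec fun b => (l b).count (f b) := by
  refine (Primrec.list_length.comp (primrec_filter (p := fun b x => x = f b) hl
    (Primrec.eq.comp Primrec.snd (hf.comp Primrec.fst)))).of_eq fun b => ?_
  rw [List.count, List.countP_eq_length_filter]
  rfl

theorem primrec_product {l : β → List τ} {m : β → List υ} (hl : Primrec l) (hm : Primrec m) :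
    Primrec fun b => l b ×ˢ m b := by
  refine (Primrec.list_flatMap (g := fun b x => (m b).map (Prod.mk x)) hl ?_).of_eq fun b => rfl
  exact Primrec.list_map (hm.comp Primrec.fst)
    (Primrec.pair (Primrec.snd.comp Primrec.fst) Primrec.snd)

theorem primrec_boundedLists {E : β → List τ} {n : β → ℕ} (hE : Primrec E) (hn : Primrec n) :
    Primrec fun b => boundedLists (E b) (n b) := by
  refine (Primrec.nat_rec' (g := fun _ => [[]]) (h := fun b y =>
    [] :: (E b).flatMap fun t => y.2.map (List.cons t)) hn (Primrec.const _) ?_).of_eq fun b => ?_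
  · refine Primrec.list_cons.comp (Primrec.const []) (Primrec.list_flatMap (hE.comp Primrec.fst) ?_)
    exact Primrec.list_map (Primrec.snd.comp (Primrec.snd.comp Primrec.fst))
      (Primrec.list_cons.comp (Primrec.snd.comp Primrec.fst) Primrec.snd)
  · induction n b with
    | zero => rfl
    | succ n ih => simp only [boundedLists, ih]

theorem primrec_letters {l : β → List Edge} (hl : Primrec l) : Primrec fun b => letters (l b) :=
  Primrec.list_map hl (Primrec.fst.comp (Primrec.snd.comp Primrec.snd))

/-- The recursion of `IsWalk` changes its start vertex. A fold carries that vertex along, with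
`none` for a broken walk, and is visibly primitive recursive. -/
theorem isWalk_iff_foldl {p q : ℕ} {l : List Edge} :
    IsWalk p l q ↔ l.foldl (fun (o : Option ℕ) t => if o = some t.1 then some t.2.2 else none)
      (some p) = some q := by
  have hnone : ∀ l : List Edge, l.foldl
      (fun (o : Option ℕ) t => if o = some t.1 then some t.2.2 else none) none = none := by
    intro l
    induction l with
    | nil => rfl
    | cons t l ih => simpa using ih
  induction l generalizing p with
  | nil => simp [IsWalk]
  | cons t l ih =>
    rw [IsWalk, List.foldl_cons]
    by_cases h : t.1 = p
    · simp [h, ih]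
    · have : ¬ some p = some t.1 := fun h' => h (Option.some.inj h').symm
      simp [h, this, hnone]

theorem primrecPred_isWalk {p q : β → ℕ} {l : β → List Edge} (hp : Primrec p) (hl : Primrec l)
    (hq : Primrec q) : PrimrecPred fun b => IsWalk (p b) (l b) (q b) := by
  refine PrimrecPred.of_eq (Primrec.eq.comp
    (Primrec.list_foldl (h := fun (_ : β) (y : Option ℕ × Edge) =>
      if y.1 = some y.2.1 then some y.2.2.2 else none) hl (Primrec.option_some.comp hp) ?_)
    (Primrec.option_some.comp hq)) fun b => isWalk_iff_foldl.symm
  refine Primrec.ite (Primrec.eq.comp (Primrec.fst.comp Primrec.snd) (Primrec.option_some.comp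
    (Primrec.fst.comp (Primrec.snd.comp Primrec.snd)))) ?_ (Primrec.const none)
  exact Primrec.option_some.comp
    (Primrec.snd.comp (Primrec.snd.comp (Primrec.snd.comp Primrec.snd)))

theorem primrec_edges {k : β → ℕ} {c : β → AutomatonCode} (hk : Primrec k) (hc : Primrec c) :
    Primrec fun b => edges (k b) (c b) := by
  have hn : Primrec fun y : β × Edge => (c y.1).numStates :=
    Primrec.fst.comp (hc.comp Primrec.fst)
  refine primrec_filter (p := fun b t => t.1 < (c b).numStates ∧ t.2.1 < k b ∧
    t.2.2 < (c b).numStates) (Primrec.fst.comp (Primrec.snd.comp hc)) ?_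
  exact (Primrec.nat_lt.comp (Primrec.fst.comp Primrec.snd) hn).and
    ((Primrec.nat_lt.comp (Primrec.fst.comp (Primrec.snd.comp Primrec.snd))
      (hk.comp Primrec.fst)).and
      (Primrec.nat_lt.comp (Primrec.snd.comp (Primrec.snd.comp Primrec.snd)) hn))

theorem primrec_starts {c : β → AutomatonCode} (hc : Primrec c) :
    Primrec fun b => starts (c b) :=
  primrec_filter (p := fun b t => t < (c b).numStates)
    (Primrec.fst.comp (Primrec.snd.comp (Primrec.snd.comp hc)))
    (Primrec.nat_lt.comp Primrec.snd (Primrec.fst.comp (hc.comp Primrec.fst)))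

theorem primrec_walkBound {n m : β → ℕ} (hn : Primrec n) (hm : Primrec m) :
    Primrec fun b => walkBound (n b) (m b) :=
  Primrec.nat_add.comp (Primrec.nat_mul.comp (Primrec.succ.comp hm) (Primrec.succ.comp hn)) hn

theorem primrec_lengthBound {k : β → ℕ} {c d : β → AutomatonCode} (hk : Primrec k)
    (hc : Primrec c) (hd : Primrec d) : Primrec fun b => lengthBound (k b) (c b) (d b) :=
  Primrec.succ.comp (Primrec.nat_add.comp
    (primrec_walkBound (Primrec.fst.comp hc) (Primrec.list_length.comp (primrec_edges hk hc)))
    (primrec_walkBound (Primrec.fst.comp hd) (Primrec.list_length.comp (primrec_edges hk hd))))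

theorem primrec_pendingBound {k : β → ℕ} {c d : β → AutomatonCode} (hk : Primrec k)
    (hc : Primrec c) (hd : Primrec d) : Primrec fun b => pendingBound (k b) (c b) (d b) :=
  Primrec.nat_mul.comp (Primrec.succ.comp (Primrec.nat_mul.comp (Primrec.const 2) hk))
    (primrec_lengthBound hk hc hd)

section Side

variable {k B M : β → ℕ} {c d : β → AutomatonCode} {S z : β → List ℕ} {x y : β → SideState}

/-- Vectors of pending letters are compared letter by letter. -/
theorem primrecPred_forall_letter (hk : Primrec k) (hS : Primrec S) {f g : β → ℕ → ℕ}
    (hf : Primrec₂ f) (hg : Primrec₂ g) :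
    PrimrecPred fun b => ∀ a ∈ List.range (k b), a ∈ S b ∨ f b a = g b a :=
  primrecPred_forall_mem (Primrec.list_range.comp hk)
    ((primrecPred_mem (hS.comp Primrec.fst) Primrec.snd).or (Primrec.eq.comp hf hg))

theorem primrec_pending (hx : Primrec x) : Primrec₂ fun b a => (x b).2.2.getD a 0 :=
  (Primrec.list_getD 0).comp (Primrec.snd.comp (Primrec.snd.comp (hx.comp Primrec.fst)))
    Primrec.snd

theorem primrecPred_shift (hk : Primrec k) (hS : Primrec S) (hz : Primrec z) (hx : Primrec x)
    (hy : Primrec y) : PrimrecPred fun b => Shift (k b) (S b) (z b) (x b) (y b) :=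
  (Primrec.eq.comp (Primrec.fst.comp hy) (Primrec.fst.comp hx)).and
    ((Primrec.eq.comp (Primrec.fst.comp (Primrec.snd.comp hy))
      (Primrec.fst.comp (Primrec.snd.comp hx))).and
      (primrecPred_forall_letter hk hS (primrec_pending hy)
        (Primrec.nat_add.comp (primrec_pending hx)
          (primrec_count (hz.comp Primrec.fst) Primrec.snd))))

theorem primrecPred_pumps (hk : Primrec k) (hB : Primrec B) (hc : Primrec c) (hS : Primrec S)
    (hx : Primrec x) (hy : Primrec y) :
    PrimrecPred fun b => Pumps (k b) (B b) (c b) (S b) (x b) (y b) := by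
  refine primrecPred_exists_mem (primrec_boundedLists (primrec_edges hk hc) hB) (.and ?_ ?_)
  · refine primrecPred_exists_mem
      (Primrec.fst.comp (Primrec.snd.comp (hx.comp Primrec.fst))) ?_
    exact primrecPred_isWalk (Primrec.fst.comp Primrec.snd) (Primrec.snd.comp Primrec.fst)
      (Primrec.fst.comp Primrec.snd)
  · exact primrecPred_shift (hk.comp Primrec.fst) (hS.comp Primrec.fst)
      (primrec_letters Primrec.snd) (hx.comp Primrec.fst) (hy.comp Primrec.fst)

theorem primrecPred_begins (hk : Primrec k) (hM : Primrec M) (hc : Primrec c) (hS : Primrec S)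
    (hx : Primrec x) : PrimrecPred fun b => Begins (k b) (M b) (c b) (S b) (x b) := by
  refine .and (primrecPred_exists_mem (primrec_starts hc) ?_) ?_
  · exact primrecPred_isWalk Primrec.snd
      (Primrec.fst.comp (Primrec.snd.comp (hx.comp Primrec.fst)))
      (Primrec.fst.comp (hx.comp Primrec.fst))
  · exact primrecPred_forall_letter hk hS (primrec_pending hx)
      (Primrec.nat_add.comp (hM.comp Primrec.fst) (primrec_count (primrec_letters
        (Primrec.fst.comp (Primrec.snd.comp (hx.comp Primrec.fst)))) Primrec.snd))

theorem primrecPred_finishes (hk : Primrec k) (hB : Primrec B) (hM : Primrec M) (hc : Primrec c)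
    (hS : Primrec S) (hx : Primrec x) :
    PrimrecPred fun b => Finishes (k b) (B b) (M b) (c b) (S b) (x b) := by
  refine .and (primrecPred_mem (Primrec.snd.comp (Primrec.snd.comp (Primrec.snd.comp hc)))
    (Primrec.fst.comp hx)) (.and (primrecPred_forall_letter hk hS (primrec_pending hx)
      (hM.comp Primrec.fst)) ?_)
  refine primrecPred_exists_mem (primrec_boundedLists (primrec_edges hk hc) hB)
    (.and (primrecPred_isWalk (Primrec.fst.comp (hx.comp Primrec.fst)) Primrec.snd
      (Primrec.fst.comp (hx.comp Primrec.fst))) (.and ?_ ?_))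
  · exact primrecPred_forall_mem (hS.comp Primrec.fst)
      (primrecPred_mem (primrec_letters (Primrec.snd.comp Primrec.fst)) Primrec.snd)
  · exact primrecPred_forall_mem (primrec_letters Primrec.snd)
      (primrecPred_mem (hS.comp (Primrec.fst.comp Primrec.fst)) Primrec.snd)

theorem primrec_sideStates (hk : Primrec k) (hB : Primrec B) (hM : Primrec M) (hc : Primrec c) :
    Primrec fun b => sideStates (k b) (B b) (M b) (c b) :=
  primrec_product (Primrec.list_range.comp (Primrec.fst.comp hc))
    (primrec_product (primrec_boundedLists (primrec_edges hk hc) hB)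
      (primrec_boundedLists (Primrec.list_range.comp (Primrec.succ.comp
        (Primrec.nat_mul.comp (Primrec.const 2) hM))) hk))

end Side

section Joint

variable {k a : β → ℕ} {c d : β → AutomatonCode} {s s' : β → JointState}

theorem primrecPred_jointStep (hk : Primrec k) (hc : Primrec c) (hd : Primrec d) (hs : Primrec s)
    (ha : Primrec a) (hs' : Primrec s') :
    PrimrecPred fun b => JointStep (k b) (c b) (d b) (s b) (a b) (s' b) := by
  have hB := primrec_lengthBound hk hc hd
  have hM := primrec_pendingBound hk hc hd
  have hS := Primrec.fst.comp hs
  have hR := Primrec.fst.comp (Primrec.snd.comp hs)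
  have hR' := Primrec.fst.comp (Primrec.snd.comp hs')
  have hD := Primrec.snd.comp (Primrec.snd.comp hs)
  have hD' := Primrec.snd.comp (Primrec.snd.comp hs')
  have hx := Primrec.fst.comp hD
  have hy := Primrec.snd.comp hD
  have hx' := Primrec.fst.comp hD'
  have hy' := Primrec.snd.comp hD'
  have hRnil : PrimrecPred fun b => (s b).2.1 = [] := Primrec.eq.comp hR (Primrec.const [])
  have hR'nil : PrimrecPred fun b => (s' b).2.1 = [] := Primrec.eq.comp hR' (Primrec.const [])
  have hR'S : PrimrecPred fun b => (s' b).2.1 = (s b).1 := Primrec.eq.comp hR' hS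
  have htail := Primrec.list_tail.comp hR
  have htailnil : PrimrecPred fun b => (s b).2.1.tail = [] :=
    Primrec.eq.comp htail (Primrec.const [])
  have haS : PrimrecPred fun b => a b ∈ (s b).1 := primrecPred_mem hS ha
  have hsingle : Primrec fun b => [a b] := Primrec.list_cons.comp ha (Primrec.const [])
  refine .and (Primrec.eq.comp (Primrec.fst.comp hs') hS) (.or ?_ (.or ?_ ?_))
  · exact .and (Primrec.eq.comp (Primrec.list_head?.comp hR) (Primrec.option_some.comp ha))
      (.and (.or (.and htailnil hR'S) (.and htailnil.not (Primrec.eq.comp hR' htail)))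
        (Primrec.eq.comp hD' hD))
  · refine .and hRnil (.and hR'nil (.or (.and haS (.or ?_ ?_)) (.and haS.not (.and ?_ ?_))))
    · exact .and (primrecPred_pumps hk hB hc hS hx hx') (Primrec.eq.comp hy' hy)
    · exact .and (primrecPred_pumps hk hB hd hS hy hy') (Primrec.eq.comp hx' hx)
    · exact primrecPred_shift hk hS hsingle hx' hx
    · exact primrecPred_shift hk hS hsingle hy' hy
  · exact .and hRnil (.and hR'S (.and haS (.and (Primrec.eq.comp hD' hD)
      (.and (primrecPred_finishes hk hB hM hc hS hx) (primrecPred_finishes hk hB hM hd hS hy)))))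

theorem primrecPred_jointStart (hk : Primrec k) (hc : Primrec c) (hd : Primrec d)
    (hs : Primrec s) : PrimrecPred fun b => JointStart (k b) (c b) (d b) (s b) := by
  have hM := primrec_pendingBound hk hc hd
  have hS := Primrec.fst.comp hs
  have hD := Primrec.snd.comp (Primrec.snd.comp hs)
  exact .and (PrimrecPred.not (Primrec.eq.comp hS (Primrec.const [])))
    (.and (Primrec.eq.comp (Primrec.fst.comp (Primrec.snd.comp hs)) (Primrec.const []))
      (.and (primrecPred_begins hk hM hc hS (Primrec.fst.comp hD))
        (primrecPred_begins hk hM hd hS (Primrec.snd.comp hD))))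

theorem primrecPred_jointAccept (hs : Primrec s) : PrimrecPred fun b => JointAccept (s b) :=
  Primrec.eq.comp (Primrec.fst.comp (Primrec.snd.comp hs)) (Primrec.fst.comp hs)

theorem primrec_jointStates (hk : Primrec k) (hc : Primrec c) (hd : Primrec d) :
    Primrec fun b => jointStates (k b) (c b) (d b) := by
  have hB := primrec_lengthBound hk hc hd
  have hM := primrec_pendingBound hk hc hd
  have hS := primrec_boundedLists (Primrec.list_range.comp hk) hk
  exact primrec_product hS (primrec_product hS
    (primrec_product (primrec_sideStates hk hB hM hc) (primrec_sideStates hk hB hM hd)))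

/-- The classical decidability in `codeOf` does no harm: `primrec_filter` accepts any decision
instance once the predicate is primitive recursive. -/
theorem primrec_jointCode (hk : Primrec k) (hc : Primrec c) (hd : Primrec d) :
    Primrec fun b => jointCode (k b) (c b) (d b) := by
  classical
  have hL := primrec_jointStates hk hc hd
  have hlen := Primrec.list_length.comp hL
  have hrange := Primrec.list_range.comp hlen
  have hget : ∀ {γ : Type _} [Primcodable γ] {f : γ → β} {i : γ → ℕ}, Primrec f → Primrec i →
      Primrec fun y => (jointStates (k (f y)) (c (f y)) (d (f y))).getD (i y) default :=
    fun hf hi => (Primrec.list_getD default).comp (hL.comp hf) hi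
  refine Primrec.pair hlen (Primrec.pair ?_ (Primrec.pair ?_ ?_))
  · refine primrec_filter
      (primrec_product hrange (primrec_product (Primrec.list_range.comp hk) hrange)) ?_
    exact primrecPred_jointStep (hk.comp Primrec.fst) (hc.comp Primrec.fst) (hd.comp Primrec.fst)
      (hget Primrec.fst (Primrec.fst.comp Primrec.snd))
      (Primrec.fst.comp (Primrec.snd.comp Primrec.snd))
      (hget Primrec.fst (Primrec.snd.comp (Primrec.snd.comp Primrec.snd)))
  · refine primrec_filter hrange ?_
    exact primrecPred_jointStart (hk.comp Primrec.fst) (hc.comp Primrec.fst) (hd.comp Primrec.fst)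
      (hget Primrec.fst Primrec.snd)
  · refine primrec_filter hrange ?_
    exact primrecPred_jointAccept (hget Primrec.fst Primrec.snd)

end Joint

end Primrec

/-! ### The intersection theorem. -/

theorem jumpingLanguage_jointCode {k : ℕ} {α Q₁ Q₂ : Type*} (e : α ≃ Fin k) (A : NFA α Q₁)
    (B : NFA α Q₂) (c d : AutomatonCode) (hc : c.Describes e A) (hd : d.Describes e B) :
    jumpingLanguage ((jointCode k c d).toNFA e) = jumpingLanguage A ∩ jumpingLanguage B := by
  classical
  ext w
  have : Fintype α := Fintype.ofEquiv _ e.symm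
  -- The Parikh image of `w` is split into its infinite letters `S` and finite counts `v`. The
  -- values of `v` on `S` are never used, and `v` vanishes beyond the alphabet.
  let S : List ℕ := (List.range k).filter fun i => ∃ h : i < k, parikh w (e.symm ⟨i, h⟩) = ⊤
  let v : ℕ → ℕ := fun i => if h : i < k then (parikh w (e.symm ⟨i, h⟩)).toNat else 0
  have hS : ∀ a, (e a : ℕ) ∈ S ↔ parikh w a = ⊤ := fun a => by simp [S]
  have hSk : ∀ i ∈ S, i < k := fun i hi => List.mem_range.1 (List.mem_filter.1 hi).1
  have hv : ∀ a, parikh w a ≠ ⊤ → parikh w a = v (e a) := fun a ha => by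
    simp [v, ENat.natCast_toNat ha]
  have hvk : ∀ i, k ≤ i → v i = 0 := fun i hi => by simp [v, Nat.not_lt.2 hi]
  have hS0 : S ≠ [] := by
    obtain ⟨N, hN⟩ := exists_forall_ge_parikh_eq_top w
    exact List.ne_nil_of_mem ((hS _).2 (hN N le_rfl))
  have hSlen : S.length ≤ k ∧ S ⊆ List.range k :=
    ⟨(List.length_filter_le _ _).trans (by simp), fun i hi => List.mem_range.2 (hSk i hi)⟩
  constructor
  · intro h
    obtain ⟨h₁, h₂⟩ := accepts_of_accepts_jointCode hS0
      (accepts_of_mem_jumpingLanguage (describes_toNFA _ e) hS hSk hv hvk h)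
    exact ⟨mem_jumpingLanguage_of_accepts hc hS hv h₁, mem_jumpingLanguage_of_accepts hd hS hv h₂⟩
  · rintro ⟨h₁, h₂⟩
    exact mem_jumpingLanguage_of_accepts (describes_toNFA _ e) hS hv (accepts_jointCode hS0 hSlen
      (accepts_of_mem_jumpingLanguage hc hS hSk hv hvk h₁)
      (accepts_of_mem_jumpingLanguage hd hS hSk hv hvk h₂))

end JumpingAutomata

/-- There is one algorithm `f` that turns the size `k` of the alphabet and descriptions `c`, `d` of
automata `A`, `B` over a common alphabet into a description of an automaton whose jumping language
is the intersection of the jumping languages of `A` and `B`. -/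
theorem mainTheorem2 :
    ∃ f : ℕ × JumpingAutomata.AutomatonCode × JumpingAutomata.AutomatonCode →
        JumpingAutomata.AutomatonCode,
      Computable f ∧
      ∀ (k : ℕ) (α : Type*) (e : α ≃ Fin k) (Q₁ : Type*) (Q₂ : Type*) [Finite Q₁] [Finite Q₂]
        (A : NFA α Q₁) (B : NFA α Q₂) (c d : JumpingAutomata.AutomatonCode),
        c.Describes e A → d.Describes e B →
          JumpingAutomata.jumpingLanguage ((f (k, c, d)).toNFA e) =
            JumpingAutomata.jumpingLanguage A ∩ JumpingAutomata.jumpingLanguage B :=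
  ⟨fun y => JumpingAutomata.jointCode y.1 y.2.1 y.2.2,
    (JumpingAutomata.primrec_jointCode Primrec.fst (Primrec.fst.comp Primrec.snd)
      (Primrec.snd.comp Primrec.snd)).to_comp,
    fun _ _ e _ _ _ _ A B c d hc hd =>
      JumpingAutomata.jumpingLanguage_jointCode e A B c d hc hd⟩
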